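/- Let $n\ge 3$, and let $\mathcal P$ be the algebra of polynomial functions on the space of complex $n\times 3$ matrices $X=(x_{ij})$, with $GL_n\times GL_3$ acting by $((g,h)\cdot f)(X)=f(g^{t}Xh)$. For $m\ge 0$ let $\mathcal Q_m\subset\mathcal P$ be the space of all $f$ such that $f(X\,\mathrm{diag}(t_1,t_2,t_3))=(t_1t_2t_3)^m f(X)$ for all $t_1,t_2,t_3\in\mathbb C^\times$, and let $\mathcal Q=\bigoplus_{m\ge0}\mathcal Q_m$. The symmetric group $S_3$ acts on $\mathcal Q$ by the algebra automorphisms $\tau.x_{ij}=x_{i\tau(j)}$; put $$\mathcal Q^{S_3}=\{f\in\mathcal Q : \tau.f=f\ \ \forall\tau\in S_3\},\qquad \mathcal Q^{\mathrm{sgn}}=\{f\in\mathcal Q : \tau.f=\mathrm{sgn}(\tau)f\ \ \forall\tau\in S_3\}.$$ Let $U_n\subset GL_n$ be the group of upper triangular matrices with all diagonal entries $1$, and for a subspace $W\subset\mathcal Q$ that is stable under $U_n$ let $W^{U_n}$ be the subspace of $U_n$-invariant elements. Put $$\delta_{ij}=\begin{vmatrix}x_{1i}&x_{1j}\\ x_{2i}&x_{2j}\end{vmatrix},\quad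 \alpha_1=x_{11}x_{12}x_{13},\quad \beta_2=x_{13}\delta_{12},\quad \beta_3=x_{12}\delta_{13},\quad \gamma_1=\det(x_{ij})_{1\le i,j\le3},\quad \gamma_2=\delta_{12}\delta_{13}\delta_{23},$$ $$\alpha_2=\beta_2^2+\beta_3^2-\beta_2\beta_3,\qquad \alpha_3=2(\beta_2^3+\beta_3^3)-3(\beta_2^2\beta_3+\beta_2\beta_3^2).$$ (i) The monomials $\alpha_1^a\alpha_2^b\alpha_3^c\gamma_1^{2d+f}\gamma_2^{2e+f}$ with $a,b,d,e\in\mathbb Z_{\ge0}$ and $c,f\in\{0,1\}$ are pairwise distinct and form a basis of the complex vector space $(\mathcal Q^{S_3})^{U_n}$. (ii) The monomials $\alpha_1^a\alpha_2^b\alpha_3^c\gamma_1^{2d+1}\gamma_2^{2e}$ and $\alpha_1^a\alpha_2^b\alpha_3^c\gamma_1^{2d}\gamma_2^{2e+1}$ with $a,b,d,e\in\mathbb Z_{\ge0}$ and $c\in\{0,1\}$ are pairwise distinct and form a basis of the complex vector space $(\mathcal Q^{\mathrm{sgn}})^{U_n}$. -/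

import Mathlib

open scoped MatrixGroups

noncomputable section

namespace Plethysm

/-- The algebra of polynomial functions on the space of complex `n × k` matrices, as the polynomial
algebra on the coordinates `x i j`. -/
abbrev P (n k : ℕ) : Type := MvPolynomial (Fin n × Fin k) ℂ

/-- The action of `(g, h) ∈ GL_n × GL_k` on polynomial functions, `((g, h) • f) (X) = f (gᵀ X h)`:
the coordinate `x i j` goes to the `(i, j)` entry of `gᵀ X h`. -/
def act {n k : ℕ} (g : GL (Fin n) ℂ) (h : GL (Fin k) ℂ) : P n k →ₐ[ℂ] P n k :=
  MvPolynomial.aeval fun p : Fin n × Fin k =>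
    ∑ s : Fin n, ∑ t : Fin k, MvPolynomial.C (g s p.1 * h t p.2) * MvPolynomial.X (s, t)

theorem eval_act {n k : ℕ} (g : GL (Fin n) ℂ) (h : GL (Fin k) ℂ) (f : P n k)
    (M : Matrix (Fin n) (Fin k) ℂ) :
    MvPolynomial.eval (fun p => M p.1 p.2) (act g h f) =
      MvPolynomial.eval (fun p => (g.val.transpose * M * h.val) p.1 p.2) f := by
  rw [act, MvPolynomial.aeval_def, MvPolynomial.eval_eval₂]
  change MvPolynomial.eval₂ _ _ f = MvPolynomial.eval₂ _ _ f
  congr 1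
  · ext z
    simp
  · funext p
    simp only [map_sum, map_mul, MvPolynomial.eval_C, MvPolynomial.eval_X, Matrix.mul_apply,
      Matrix.transpose_apply, Finset.sum_mul]
    rw [Finset.sum_comm]
    refine Finset.sum_congr rfl fun t _ => Finset.sum_congr rfl fun s _ => ?_
    ring

/-- The diagonal element `diag(t_1, …, t_k)` of `GL_k`. -/
def diagGL {k : ℕ} (t : Fin k → ℂˣ) : GL (Fin k) ℂ where
  val := Matrix.diagonal fun j => (t j : ℂ)
  inv := Matrix.diagonal fun j => ((t j)⁻¹ : ℂˣ)
  val_inv := by simp [Matrix.diagonal_mul_diagonal]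
  inv_val := by simp [Matrix.diagonal_mul_diagonal]

/-- The multihomogeneous component of multidegree `m = (m_1, …, m_k)`: the polynomial functions on
which the diagonal torus of `GL_k` acts by the character `t ↦ t_1 ^ m_1 ⋯ t_k ^ m_k`. -/
def Pgr (n k : ℕ) (m : Fin k → ℕ) : Submodule ℂ (P n k) where
  carrier := {f | ∀ t : Fin k → ℂˣ, act 1 (diagGL t) f = (∏ j, (t j : ℂ) ^ m j) • f}
  add_mem' := fun ha hb t => by rw [map_add, ha t, hb t, smul_add]
  zero_mem' := fun t => by simp
  smul_mem' := fun c f hf t => by rw [map_smul, hf t, smul_comm]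

/-- `Q` is the sum of the components of multidegree `(m, m, …, m)`. -/
def Q (n k : ℕ) : Submodule ℂ (P n k) :=
  ⨆ m : ℕ, Pgr n k fun _ => m

/-- The action of the symmetric group on polynomial functions, `τ • x i j = x i (τ j)`. -/
def permAct {n k : ℕ} (τ : Equiv.Perm (Fin k)) : P n k →ₐ[ℂ] P n k :=
  MvPolynomial.rename fun p : Fin n × Fin k => (p.1, τ p.2)

/-- `Q ^ S_k`: the elements of `Q` that are fixed by the symmetric group. -/
def Qinv (n k : ℕ) : Submodule ℂ (P n k) where
  carrier := {f | f ∈ Q n k ∧ ∀ τ : Equiv.Perm (Fin k), permAct τ f = f}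
  add_mem' := fun ha hb => ⟨add_mem ha.1 hb.1, fun τ => by rw [map_add, ha.2 τ, hb.2 τ]⟩
  zero_mem' := ⟨zero_mem _, fun τ => map_zero _⟩
  smul_mem' := fun c f hf => ⟨Submodule.smul_mem _ c hf.1, fun τ => by rw [map_smul, hf.2 τ]⟩

/-- `Q ^ sgn`: the elements of `Q` on which the symmetric group acts by the sign character. -/
def Qsgn (n k : ℕ) : Submodule ℂ (P n k) where
  carrier := {f | f ∈ Q n k ∧
    ∀ τ : Equiv.Perm (Fin k), permAct τ f = ((Equiv.Perm.sign τ : ℤ) : ℂ) • f}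
  add_mem' := fun ha hb => ⟨add_mem ha.1 hb.1, fun τ => by rw [map_add, ha.2 τ, hb.2 τ, smul_add]⟩
  zero_mem' := ⟨zero_mem _, fun τ => by simp⟩
  smul_mem' := fun c f hf =>
    ⟨Submodule.smul_mem _ c hf.1, fun τ => by rw [map_smul, hf.2 τ, smul_comm]⟩

/-- The subgroup `U_n` of `GL_n` of upper triangular matrices with all diagonal entries `1`. -/
def U (n : ℕ) : Subgroup (GL (Fin n) ℂ) where
  carrier := {g | (∀ i j, j < i → g i j = 0) ∧ ∀ i, g i i = 1}
  one_mem' := ⟨fun i j h => by simp [h.ne'], fun i => by simp⟩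
  mul_mem' := by
    rintro a b ⟨ha, ha'⟩ ⟨hb, hb'⟩
    refine ⟨fun i j hij => ?_, fun i => ?_⟩
    · rw [Matrix.GeneralLinearGroup.coe_mul, Matrix.mul_apply]
      refine Finset.sum_eq_zero fun s _ => ?_
      rcases lt_or_ge s i with h | h
      · rw [ha i s h, zero_mul]
      · rw [hb s j (hij.trans_le h), mul_zero]
    · rw [Matrix.GeneralLinearGroup.coe_mul, Matrix.mul_apply, Finset.sum_eq_single i]
      · rw [ha', hb', mul_one]
      · intro s _ hs
        rcases lt_or_gt_of_ne hs with h | h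
        · rw [ha i s h, zero_mul]
        · rw [hb s i h, mul_zero]
      · simp
  inv_mem' := by
    rintro g ⟨hg, hg'⟩
    have hT : Matrix.BlockTriangular g.val id := fun i j h => hg i j h
    have : Invertible g.val := g.invertible
    have hI : Matrix.BlockTriangular (g⁻¹).val id := by
      rw [Matrix.coe_units_inv]
      exact Matrix.blockTriangular_inv_of_blockTriangular hT
    refine ⟨fun i j h => hI h, fun i => ?_⟩
    have h1 : (g.val * (g⁻¹).val) i i = 1 := by
      rw [← Units.val_mul, mul_inv_cancel]
      simp
    rw [Matrix.mul_apply, Finset.sum_eq_single i] at h1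
    · rwa [hg' i, one_mul] at h1
    · intro s _ hs
      rcases lt_or_gt_of_ne hs with h | h
      · rw [hg i s h, zero_mul]
      · rw [show (g⁻¹).val s i = 0 from hI h, mul_zero]
    · simp

/-- `W ^ U_n`: the elements of a space `W` of polynomial functions that are fixed by `U_n`. -/
def unipInv {n k : ℕ} (W : Submodule ℂ (P n k)) : Submodule ℂ (P n k) where
  carrier := {f | f ∈ W ∧ ∀ g ∈ U n, act g 1 f = f}
  add_mem' := fun ha hb => ⟨add_mem ha.1 hb.1, fun g hg => by rw [map_add, ha.2 g hg, hb.2 g hg]⟩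
  zero_mem' := ⟨zero_mem _, fun g _ => map_zero _⟩
  smul_mem' := fun c f hf => ⟨Submodule.smul_mem _ c hf.1, fun g hg => by rw [map_smul, hf.2 g hg]⟩

section Generators

variable {n : ℕ} (hn : 3 ≤ n)

/-- The coordinates in the first three rows of an `n × 3` matrix; the indices `0, 1, 2` stand for
`1, 2, 3`. -/
def x (i j : Fin 3) : P n 3 := MvPolynomial.X (Fin.castLE hn i, j)

/-- The minor of the rows `1, 2` and the columns `i, j`. -/
def δ (i j : Fin 3) : P n 3 :=
  Matrix.det !![x hn 0 i, x hn 0 j; x hn 1 i, x hn 1 j]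

def α₁ : P n 3 := x hn 0 0 * x hn 0 1 * x hn 0 2

def β₂ : P n 3 := x hn 0 2 * δ hn 0 1

def β₃ : P n 3 := x hn 0 1 * δ hn 0 2

def γ₁ : P n 3 := Matrix.det (Matrix.of fun i j : Fin 3 => x hn i j)

def γ₂ : P n 3 := δ hn 0 1 * δ hn 0 2 * δ hn 1 2

def α₂ : P n 3 := β₂ hn ^ 2 + β₃ hn ^ 2 - β₂ hn * β₃ hn

def α₃ : P n 3 :=
  2 * (β₂ hn ^ 3 + β₃ hn ^ 3) - 3 * (β₂ hn ^ 2 * β₃ hn + β₂ hn * β₃ hn ^ 2)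

/-- The exponents `(a, b, c, d, e, f)` with `c, f ∈ {0, 1}`. -/
abbrev InvIndex : Type := ℕ × ℕ × Fin 2 × ℕ × ℕ × Fin 2

def Binv : InvIndex → P n 3
  | (a, b, c, d, e, f) =>
    α₁ hn ^ a * α₂ hn ^ b * α₃ hn ^ (c : ℕ) *
      γ₁ hn ^ (2 * d + (f : ℕ)) * γ₂ hn ^ (2 * e + (f : ℕ))

/-- The exponents `(a, b, c, d, e)` with `c ∈ {0, 1}`. -/
abbrev SgnIndex : Type := ℕ × ℕ × Fin 2 × ℕ × ℕ

/-- The two kinds of monomials in the second basis, one for each summand of the index set. -/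
def Bsgn : SgnIndex ⊕ SgnIndex → P n 3
  | Sum.inl (a, b, c, d, e) =>
    α₁ hn ^ a * α₂ hn ^ b * α₃ hn ^ (c : ℕ) * γ₁ hn ^ (2 * d + 1) * γ₂ hn ^ (2 * e)
  | Sum.inr (a, b, c, d, e) =>
    α₁ hn ^ a * α₂ hn ^ b * α₃ hn ^ (c : ℕ) * γ₁ hn ^ (2 * d) * γ₂ hn ^ (2 * e + 1)

end Generators

/-- The family `v` is a basis of the subspace `W`: it is linearly independent and spans `W`. -/
def IsBasisOf {ι V : Type*} [AddCommGroup V] [Module ℂ V] (v : ι → V) (W : Submodule ℂ V) : Prop :=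
  LinearIndependent ℂ v ∧ Submodule.span ℂ (Set.range v) = W

end Plethysm

end

open scoped MatrixGroups

noncomputable section

namespace Plethysm

/-! ### The generators under `U n`, the column torus and the column permutations. -/

section Actions

open MvPolynomial (X C)

/-! The core is that every `U n`-invariant in `Q` lies in the algebra A generated by α₁, β₂, β₃, γ₁,
γ₂ (`mem_genAlg_of_mem_Q`). Where α₁β₂γ₁ ≠ 0, lower unitriangular row operations and a column
scaling of determinant 1 bring a matrix to the rows (1, 1, s), (0, a, b), (0, 0, c) with zeros
below. Evaluating the invariants there forces s = α₁, a = β₂/α₁, b = β₃, c = γ₁α₁/β₂, so (α₁β₂)^N f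
lies in A for some N (`exists_pow_mul_mem_genAlg`). The denominators cancel because of the relation
α₁γ₂ = β₂β₃(β₃ - β₂): if α₁K or β₂K is in A, so is K (`mem_genAlg_of_α₁_mul_mem`,
`mem_genAlg_of_β₂_mul_mem`).

The group S₃ acts on the span of β₂, β₃ as its reflection representation, with basic invariants α₂,
α₃ and discriminant relation α₃² = 4α₂³ - 27α₁²γ₂²; it fixes α₁ and acts on γ₁, γ₂ by the sign. Over
the algebra generated by α₁, α₂, α₃, γ₁, γ₂, the elements 1, β₂, β₃, β₂², β₃² generate A
(`exists_coinvSum_of_mem_genAlg`). Averaging over S₃, with or without signs, then leaves only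
monomials of the right parity in γ₁, γ₂, and the discriminant relation reduces the exponent of α₃ to
0 or 1.

Independence follows by restricting to the normal forms: as polynomials in b, the monomials have
distinct pairs of degree and leading monomial (`linearIndependent_genMonomial`). -/

theorem sum_eq_sum_castLE {M : Type*} [AddCommMonoid M] {k n : ℕ} (h : k ≤ n) (F : Fin n → M)
    (hF : ∀ s : Fin n, k ≤ s.val → F s = 0) : ∑ s, F s = ∑ j : Fin k, F (Fin.castLE h j) := by
  obtain ⟨m, rfl⟩ := Nat.exists_eq_add_of_le h
  rw [Fin.sum_univ_add, Finset.sum_eq_zero (s := (Finset.univ : Finset (Fin m)))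
    (fun i _ => hF _ (by simp)), add_zero]
  rfl

variable {n : ℕ} (hn : 3 ≤ n)

section Unipotent

variable {g : GL (Fin n) ℂ} (hg : g ∈ U n)
include hg

theorem act_x (i j : Fin 3) :
    act g 1 (x hn i j) = ∑ s : Fin 3, C (g (Fin.castLE hn s) (Fin.castLE hn i)) * x hn s j := by
  have h1 : act g 1 (x hn i j) = ∑ s : Fin n, C (g s (Fin.castLE hn i)) * X (s, j) := by
    simp only [act, x, MvPolynomial.aeval_X]
    refine Finset.sum_congr rfl fun s _ => ?_
    rw [Finset.sum_eq_single j]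
    · simp
    · intro t _ ht
      simp [Matrix.one_apply_ne ht]
    · simp
  rw [h1, sum_eq_sum_castLE hn]
  · rfl
  · intro s hs
    rw [hg.1 s (Fin.castLE hn i) (by rw [Fin.lt_def]; simpa using i.2.trans_le hs)]
    simp

theorem act_x_zero (j : Fin 3) : act g 1 (x hn 0 j) = x hn 0 j := by
  rw [act_x hn hg, Fin.sum_univ_three, hg.2,
    hg.1 (Fin.castLE hn 1) (Fin.castLE hn 0) (by simp [Fin.lt_def]),
    hg.1 (Fin.castLE hn 2) (Fin.castLE hn 0) (by simp [Fin.lt_def])]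
  simp

theorem act_x_one (j : Fin 3) : act g 1 (x hn 1 j) =
    C (g (Fin.castLE hn 0) (Fin.castLE hn 1)) * x hn 0 j + x hn 1 j := by
  rw [act_x hn hg, Fin.sum_univ_three, hg.2,
    hg.1 (Fin.castLE hn 2) (Fin.castLE hn 1) (by simp [Fin.lt_def])]
  simp

theorem act_x_two (j : Fin 3) : act g 1 (x hn 2 j) =
    C (g (Fin.castLE hn 0) (Fin.castLE hn 2)) * x hn 0 j +
      C (g (Fin.castLE hn 1) (Fin.castLE hn 2)) * x hn 1 j + x hn 2 j := by
  rw [act_x hn hg, Fin.sum_univ_three, hg.2]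
  simp

theorem act_δ (i j : Fin 3) : act g 1 (δ hn i j) = δ hn i j := by
  simp only [δ, Matrix.det_fin_two_of, map_sub, map_mul, act_x_zero hn hg, act_x_one hn hg]
  ring

theorem act_γ₁ : act g 1 (γ₁ hn) = γ₁ hn := by
  simp only [γ₁, Matrix.det_fin_three, Matrix.of_apply, map_sub, map_add, map_mul,
    act_x_zero hn hg, act_x_one hn hg, act_x_two hn hg]
  ring

theorem act_α₁ : act g 1 (α₁ hn) = α₁ hn := by
  simp only [α₁, map_mul, act_x_zero hn hg]

theorem act_β₂ : act g 1 (β₂ hn) = β₂ hn := by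
  simp only [β₂, map_mul, act_x_zero hn hg, act_δ hn hg]

theorem act_β₃ : act g 1 (β₃ hn) = β₃ hn := by
  simp only [β₃, map_mul, act_x_zero hn hg, act_δ hn hg]

theorem act_γ₂ : act g 1 (γ₂ hn) = γ₂ hn := by
  simp only [γ₂, map_mul, act_δ hn hg]

theorem act_α₂ : act g 1 (α₂ hn) = α₂ hn := by
  simp only [α₂, map_mul, map_sub, map_add, map_pow, act_β₂ hn hg, act_β₃ hn hg]

theorem act_α₃ : act g 1 (α₃ hn) = α₃ hn := by
  simp only [α₃, map_mul, map_sub, map_add, map_pow, act_β₂ hn hg, act_β₃ hn hg, map_ofNat]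

end Unipotent

section Grading

theorem act_diagGL_X {k : ℕ} (t : Fin k → ℂˣ) (i : Fin n) (j : Fin k) :
    act 1 (diagGL t) (X (i, j) : P n k) = (t j : ℂ) • X (i, j) := by
  have h (s : Fin n) (u : Fin k) : ((1 : GL (Fin n) ℂ) s i * (diagGL t) u j : ℂ) =
      if s = i ∧ u = j then (t j : ℂ) else 0 := by
    rw [Units.val_one, Matrix.one_apply, show (diagGL t) u j = Matrix.diagonal _ u j from rfl,
      Matrix.diagonal_apply]
    by_cases hs : s = i <;> by_cases hu : u = j <;> simp [hs, hu]
  rw [act, MvPolynomial.aeval_X, Finset.sum_eq_single i, Finset.sum_eq_single j]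
  · dsimp only
    rw [h, MvPolynomial.smul_eq_C_mul, if_pos ⟨rfl, rfl⟩]
  · intro u _ hu
    dsimp only
    rw [h, if_neg (by simp [hu]), C.map_zero, zero_mul]
  · simp
  · intro s _ hs
    refine Finset.sum_eq_zero fun u _ => ?_
    dsimp only
    rw [h, if_neg (by simp [hs]), C.map_zero, zero_mul]
  · simp

theorem mul_mem_Pgr {k : ℕ} {m m' : Fin k → ℕ} {f f' : P n k} (hf : f ∈ Pgr n k m)
    (hf' : f' ∈ Pgr n k m') : f * f' ∈ Pgr n k (m + m') := fun t => by
  rw [map_mul, hf t, hf' t, smul_mul_smul_comm, ← Finset.prod_mul_distrib]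
  simp only [Pi.add_apply, pow_add]

theorem one_mem_Pgr {k : ℕ} : (1 : P n k) ∈ Pgr n k 0 := fun t => by simp

theorem pow_mem_Pgr {k : ℕ} {m : Fin k → ℕ} {f : P n k} (hf : f ∈ Pgr n k m) (a : ℕ) :
    f ^ a ∈ Pgr n k (a • m) := by
  induction a with
  | zero => simpa using one_mem_Pgr
  | succ a ih => rw [pow_succ, succ_nsmul]; exact mul_mem_Pgr ih hf

theorem α₁_mem_Pgr : α₁ hn ∈ Pgr n 3 (fun _ => 1) := fun t => by
  simp only [α₁, x, map_mul, act_diagGL_X, Fin.prod_univ_three, pow_one,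
    MvPolynomial.smul_eq_C_mul]
  ring

theorem β₂_mem_Pgr : β₂ hn ∈ Pgr n 3 (fun _ => 1) := fun t => by
  simp only [β₂, δ, x, Matrix.det_fin_two_of, map_mul, map_sub, act_diagGL_X, Fin.prod_univ_three,
    pow_one, MvPolynomial.smul_eq_C_mul]
  ring

theorem β₃_mem_Pgr : β₃ hn ∈ Pgr n 3 (fun _ => 1) := fun t => by
  simp only [β₃, δ, x, Matrix.det_fin_two_of, map_mul, map_sub, act_diagGL_X, Fin.prod_univ_three,
    pow_one, MvPolynomial.smul_eq_C_mul]
  ring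

theorem γ₁_mem_Pgr : γ₁ hn ∈ Pgr n 3 (fun _ => 1) := fun t => by
  simp only [γ₁, x, Matrix.det_fin_three, Matrix.of_apply, map_mul, map_sub, map_add, act_diagGL_X,
    Fin.prod_univ_three, pow_one, MvPolynomial.smul_eq_C_mul]
  ring

theorem γ₂_mem_Pgr : γ₂ hn ∈ Pgr n 3 (fun _ => 2) := fun t => by
  simp only [γ₂, δ, x, Matrix.det_fin_two_of, map_mul, map_sub, act_diagGL_X,
    Fin.prod_univ_three, MvPolynomial.smul_eq_C_mul, map_pow]
  ring

theorem α₂_mem_Pgr : α₂ hn ∈ Pgr n 3 (fun _ => 2) := fun t => by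
  have h2 := β₂_mem_Pgr hn t
  have h3 := β₃_mem_Pgr hn t
  simp only [α₂, map_mul, map_sub, map_add, map_pow, h2, h3, Fin.prod_univ_three,
    MvPolynomial.smul_eq_C_mul]
  ring

theorem α₃_mem_Pgr : α₃ hn ∈ Pgr n 3 (fun _ => 3) := fun t => by
  have h2 := β₂_mem_Pgr hn t
  have h3 := β₃_mem_Pgr hn t
  simp only [α₃, map_mul, map_sub, map_add, map_pow, h2, h3, Fin.prod_univ_three, map_ofNat,
    MvPolynomial.smul_eq_C_mul]
  ring

/-- A monomial in `α₁, α₂, α₃, γ₁, γ₂`. -/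
def genMonomial (a b c d e : ℕ) : P n 3 :=
  α₁ hn ^ a * α₂ hn ^ b * α₃ hn ^ c * γ₁ hn ^ d * γ₂ hn ^ e

theorem genMonomial_mem_Q (a b c d e : ℕ) : genMonomial hn a b c d e ∈ Q n 3 := by
  refine Submodule.mem_iSup_of_mem (a + 2 * b + 3 * c + d + 2 * e) ?_
  have h := mul_mem_Pgr (mul_mem_Pgr (mul_mem_Pgr (mul_mem_Pgr (pow_mem_Pgr (α₁_mem_Pgr hn) a)
    (pow_mem_Pgr (α₂_mem_Pgr hn) b)) (pow_mem_Pgr (α₃_mem_Pgr hn) c))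
    (pow_mem_Pgr (γ₁_mem_Pgr hn) d)) (pow_mem_Pgr (γ₂_mem_Pgr hn) e)
  rw [genMonomial]
  convert h using 2
  funext j
  simp only [Pi.add_apply, Pi.smul_apply, smul_eq_mul]
  ring

theorem act_genMonomial {g : GL (Fin n) ℂ} (hg : g ∈ U n) (a b c d e : ℕ) :
    act g 1 (genMonomial hn a b c d e) = genMonomial hn a b c d e := by
  simp only [genMonomial, map_mul, map_pow, act_α₁ hn hg, act_α₂ hn hg, act_α₃ hn hg, act_γ₁ hn hg,
    act_γ₂ hn hg]

/-- On each summand the torus acts by a power of t₁t₂t₃. This invariance is all that the reduction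
to normal form needs from membership in `Q`. -/
theorem act_diagGL_of_mem_Q {f : P n 3} (hf : f ∈ Q n 3) (t : Fin 3 → ℂˣ)
    (ht : ∏ j, (t j : ℂ) = 1) : act 1 (diagGL t) f = f := by
  induction hf using Submodule.iSup_induction' with
  | mem m f hf => rw [hf t, Finset.prod_pow, ht, one_pow, one_smul]
  | zero => simp
  | add f f' _ _ h h' => rw [map_add, h, h']

end Grading

section Permutations

theorem permAct_x (τ : Equiv.Perm (Fin 3)) (i j : Fin 3) :
    permAct τ (x hn i j) = x hn i (τ j) := by
  simp [permAct, x]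

theorem permAct_mul {k : ℕ} (σ τ : Equiv.Perm (Fin k)) (f : P n k) :
    permAct (σ * τ) f = permAct σ (permAct τ f) := by
  simp only [permAct, MvPolynomial.rename_rename]
  rfl

theorem permAct_one {k : ℕ} (f : P n k) : permAct 1 f = f :=
  MvPolynomial.rename_id_apply f

/-- The transposition of the last two columns. -/
abbrev s₂₃ : Equiv.Perm (Fin 3) := Equiv.swap 1 2

/-- The transposition of the first two columns. -/
abbrev s₁₂ : Equiv.Perm (Fin 3) := Equiv.swap 0 1

theorem perm_fin_three (τ : Equiv.Perm (Fin 3)) : τ = 1 ∨ τ = s₂₃ ∨ τ = s₁₂ ∨ τ = s₂₃ * s₁₂ ∨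
    τ = s₁₂ * s₂₃ ∨ τ = s₂₃ * s₁₂ * s₂₃ := by
  revert τ
  decide

theorem s₂₃_x_zero (i : Fin 3) : permAct s₂₃ (x hn i 0) = x hn i 0 := by rw [permAct_x]; rfl
theorem s₂₃_x_one (i : Fin 3) : permAct s₂₃ (x hn i 1) = x hn i 2 := by rw [permAct_x]; rfl
theorem s₂₃_x_two (i : Fin 3) : permAct s₂₃ (x hn i 2) = x hn i 1 := by rw [permAct_x]; rfl
theorem s₁₂_x_zero (i : Fin 3) : permAct s₁₂ (x hn i 0) = x hn i 1 := by rw [permAct_x]; rfl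
theorem s₁₂_x_one (i : Fin 3) : permAct s₁₂ (x hn i 1) = x hn i 0 := by rw [permAct_x]; rfl
theorem s₁₂_x_two (i : Fin 3) : permAct s₁₂ (x hn i 2) = x hn i 2 := by rw [permAct_x]; rfl

theorem s₂₃_α₁ : permAct s₂₃ (α₁ hn) = α₁ hn := by
  simp only [α₁, map_mul, s₂₃_x_zero, s₂₃_x_one, s₂₃_x_two]
  ring

theorem s₁₂_α₁ : permAct s₁₂ (α₁ hn) = α₁ hn := by
  simp only [α₁, map_mul, s₁₂_x_zero, s₁₂_x_one, s₁₂_x_two]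
  ring

theorem s₂₃_β₂ : permAct s₂₃ (β₂ hn) = β₃ hn := by
  simp only [β₂, β₃, δ, Matrix.det_fin_two_of, map_mul, map_sub, s₂₃_x_zero, s₂₃_x_one, s₂₃_x_two]

theorem s₂₃_β₃ : permAct s₂₃ (β₃ hn) = β₂ hn := by
  simp only [β₂, β₃, δ, Matrix.det_fin_two_of, map_mul, map_sub, s₂₃_x_zero, s₂₃_x_one, s₂₃_x_two]

theorem s₁₂_β₂ : permAct s₁₂ (β₂ hn) = -β₂ hn := by
  simp only [β₂, δ, Matrix.det_fin_two_of, map_mul, map_sub, s₁₂_x_zero, s₁₂_x_one, s₁₂_x_two]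
  ring

theorem s₁₂_β₃ : permAct s₁₂ (β₃ hn) = β₃ hn - β₂ hn := by
  simp only [β₂, β₃, δ, Matrix.det_fin_two_of, map_mul, map_sub, s₁₂_x_zero, s₁₂_x_one, s₁₂_x_two]
  ring

theorem s₂₃_γ₁ : permAct s₂₃ (γ₁ hn) = -γ₁ hn := by
  simp only [γ₁, Matrix.det_fin_three, Matrix.of_apply, map_mul, map_sub, map_add, s₂₃_x_zero,
    s₂₃_x_one, s₂₃_x_two]
  ring

theorem s₁₂_γ₁ : permAct s₁₂ (γ₁ hn) = -γ₁ hn := by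
  simp only [γ₁, Matrix.det_fin_three, Matrix.of_apply, map_mul, map_sub, map_add, s₁₂_x_zero,
    s₁₂_x_one, s₁₂_x_two]
  ring

theorem s₂₃_γ₂ : permAct s₂₃ (γ₂ hn) = -γ₂ hn := by
  simp only [γ₂, δ, Matrix.det_fin_two_of, map_mul, map_sub, s₂₃_x_zero, s₂₃_x_one, s₂₃_x_two]
  ring

theorem s₁₂_γ₂ : permAct s₁₂ (γ₂ hn) = -γ₂ hn := by
  simp only [γ₂, δ, Matrix.det_fin_two_of, map_mul, map_sub, s₁₂_x_zero, s₁₂_x_one, s₁₂_x_two]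
  ring

theorem s₂₃_α₂ : permAct s₂₃ (α₂ hn) = α₂ hn := by
  simp only [α₂, map_mul, map_sub, map_add, map_pow, s₂₃_β₂, s₂₃_β₃]
  ring

theorem s₁₂_α₂ : permAct s₁₂ (α₂ hn) = α₂ hn := by
  simp only [α₂, map_mul, map_sub, map_add, map_pow, s₁₂_β₂, s₁₂_β₃]
  ring

theorem s₂₃_α₃ : permAct s₂₃ (α₃ hn) = α₃ hn := by
  simp only [α₃, map_mul, map_sub, map_add, map_pow, map_ofNat, s₂₃_β₂, s₂₃_β₃]
  ring

theorem s₁₂_α₃ : permAct s₁₂ (α₃ hn) = α₃ hn := by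
  simp only [α₃, map_mul, map_sub, map_add, map_pow, map_ofNat, s₁₂_β₂, s₁₂_β₃]
  ring

theorem permAct_eq_self {f : P n 3} (h : permAct s₂₃ f = f) (h' : permAct s₁₂ f = f)
    (τ : Equiv.Perm (Fin 3)) : permAct τ f = f := by
  rcases perm_fin_three τ with rfl | rfl | rfl | rfl | rfl | rfl <;>
    simp only [permAct_mul, permAct_one, h, h']

theorem permAct_eq_sign_smul {f : P n 3} (h : permAct s₂₃ f = -f) (h' : permAct s₁₂ f = -f)
    (τ : Equiv.Perm (Fin 3)) : permAct τ f = ((Equiv.Perm.sign τ : ℤ) : ℂ) • f := by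
  have hs : Equiv.Perm.sign s₂₃ = -1 := Equiv.Perm.sign_swap (by decide)
  have hr : Equiv.Perm.sign s₁₂ = -1 := Equiv.Perm.sign_swap (by decide)
  rcases perm_fin_three τ with rfl | rfl | rfl | rfl | rfl | rfl <;>
    simp [permAct_mul, permAct_one, h, h', hs, hr]

theorem s₂₃_genMonomial (a b c d e : ℕ) :
    permAct s₂₃ (genMonomial hn a b c d e) = (-1) ^ (d + e) * genMonomial hn a b c d e := by
  simp only [genMonomial, map_mul, map_pow, s₂₃_α₁, s₂₃_α₂, s₂₃_α₃, s₂₃_γ₁, s₂₃_γ₂,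
    neg_pow (γ₁ hn), neg_pow (γ₂ hn), pow_add]
  ring

theorem s₁₂_genMonomial (a b c d e : ℕ) :
    permAct s₁₂ (genMonomial hn a b c d e) = (-1) ^ (d + e) * genMonomial hn a b c d e := by
  simp only [genMonomial, map_mul, map_pow, s₁₂_α₁, s₁₂_α₂, s₁₂_α₃, s₁₂_γ₁, s₁₂_γ₂,
    neg_pow (γ₁ hn), neg_pow (γ₂ hn), pow_add]
  ring

theorem genMonomial_mem_unipInv_Qinv {a b c d e : ℕ} (h : Even (d + e)) :
    genMonomial hn a b c d e ∈ unipInv (Qinv n 3) :=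
  ⟨⟨genMonomial_mem_Q hn a b c d e, permAct_eq_self
    (by rw [s₂₃_genMonomial, h.neg_one_pow, one_mul])
    (by rw [s₁₂_genMonomial, h.neg_one_pow, one_mul])⟩,
    fun _ hg => act_genMonomial hn hg a b c d e⟩

theorem genMonomial_mem_unipInv_Qsgn {a b c d e : ℕ} (h : Odd (d + e)) :
    genMonomial hn a b c d e ∈ unipInv (Qsgn n 3) :=
  ⟨⟨genMonomial_mem_Q hn a b c d e, permAct_eq_sign_smul
    (by rw [s₂₃_genMonomial, h.neg_one_pow, neg_one_mul])
    (by rw [s₁₂_genMonomial, h.neg_one_pow, neg_one_mul])⟩,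
    fun _ hg => act_genMonomial hn hg a b c d e⟩

theorem span_Binv_le : Submodule.span ℂ (Set.range (Binv hn)) ≤ unipInv (Qinv n 3) := by
  rw [Submodule.span_le]
  rintro _ ⟨⟨a, b, c, d, e, f⟩, rfl⟩
  exact genMonomial_mem_unipInv_Qinv hn ⟨d + e + f, by ring⟩

theorem span_Bsgn_le : Submodule.span ℂ (Set.range (Bsgn hn)) ≤ unipInv (Qsgn n 3) := by
  rw [Submodule.span_le]
  rintro _ ⟨⟨a, b, c, d, e⟩ | ⟨a, b, c, d, e⟩, rfl⟩
  · exact genMonomial_mem_unipInv_Qsgn hn ⟨d + e, by ring⟩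
  · exact genMonomial_mem_unipInv_Qsgn hn ⟨d + e, by ring⟩

end Permutations

end Actions

/-! ### Linear independence through leading terms on a slice. -/

section LinearIndependence

open Polynomial

theorem linearIndependent_of_leadingCoeff_eq_monomial {ι σ : Type*}
    {v : ι → (MvPolynomial σ ℂ)[X]} {d : ι → ℕ} {e : ι → σ →₀ ℕ} {u : ι → ℂ}
    (hu : ∀ i, u i ≠ 0) (hd : ∀ i, (v i).natDegree = d i)
    (hl : ∀ i, (v i).leadingCoeff = MvPolynomial.monomial (e i) (u i))
    (hinj : Function.Injective fun i => (d i, e i)) : LinearIndependent ℂ v := by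
  classical
  rw [linearIndependent_iff']
  intro s
  by_contra! ⟨g, hg, i₁, hi₁, hgi₁⟩
  obtain ⟨i, hi, hmax⟩ := Finset.exists_max_image {i ∈ s | g i ≠ 0} d
    ⟨i₁, Finset.mem_filter.2 ⟨hi₁, hgi₁⟩⟩
  rw [Finset.mem_filter] at hi
  -- With `d i` maximal among the indices of nonzero coefficient, only the `i`-th term can
  -- contribute here: lower degrees vanish, and equal degrees have another leading monomial.
  have h := congrArg (fun p => ((p.coeff (d i)).coeff (e i))) hg
  simp only [finsetSum_coeff, MvPolynomial.coeff_sum, coeff_smul, MvPolynomial.coeff_smul,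
    coeff_zero, MvPolynomial.coeff_zero] at h
  have hi' : (v i).coeff (d i) = MvPolynomial.monomial (e i) (u i) := by rw [← hl, ← hd]; rfl
  rw [Finset.sum_eq_single i, hi', MvPolynomial.coeff_monomial, if_pos rfl] at h
  · exact (mul_ne_zero hi.2 (hu i)) h
  · intro j hj hji
    by_cases hgj : g j = 0
    · rw [hgj, zero_smul]
    have hle := hmax j (Finset.mem_filter.2 ⟨hj, hgj⟩)
    rcases hle.lt_or_eq with hlt | heq
    · rw [coeff_eq_zero_of_natDegree_lt (by rwa [hd]), MvPolynomial.coeff_zero, smul_zero]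
    · have hj' : (v j).coeff (d i) = MvPolynomial.monomial (e j) (u j) := by
        rw [← hl, ← heq, ← hd]; rfl
      rw [hj', MvPolynomial.coeff_monomial, if_neg, smul_zero]
      intro he
      exact hji (hinj (Prod.ext heq he))
  · exact fun h => absurd hi.1 h

variable {n : ℕ} (hn : 3 ≤ n)

/-- The restriction of polynomial functions to the matrices with rows `(1, 1, s)`, `(0, a, b)`,
`(0, 0, c)` and zeros below, as polynomials in `b` over `ℂ[s, a, c]`. -/
def restrictSlice : P n 3 →ₐ[ℂ] (MvPolynomial (Fin 3) ℂ)[X] :=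
  MvPolynomial.aeval fun p => if h : p.1.val < 3 then
    !![1, 1, C (MvPolynomial.X 0); 0, C (MvPolynomial.X 1), X; 0, 0, C (MvPolynomial.X 2)]
      ⟨p.1.val, h⟩ p.2 else 0

theorem restrictSlice_x (i j : Fin 3) : restrictSlice (x hn i j) =
    !![1, 1, C (MvPolynomial.X 0); 0, C (MvPolynomial.X 1), X; 0, 0, C (MvPolynomial.X 2)] i j := by
  simp [restrictSlice, x]

theorem restrictSlice_α₁ : restrictSlice (α₁ hn) = C (MvPolynomial.X 0) := by
  simp [α₁, restrictSlice_x]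

theorem restrictSlice_β₂ : restrictSlice (β₂ hn) = C (MvPolynomial.X 0 * MvPolynomial.X 1) := by
  simp [β₂, δ, restrictSlice_x]

theorem restrictSlice_β₃ : restrictSlice (β₃ hn) = X := by
  simp [β₃, δ, restrictSlice_x]

theorem restrictSlice_γ₁ : restrictSlice (γ₁ hn) = C (MvPolynomial.X 1 * MvPolynomial.X 2) := by
  simp [γ₁, Matrix.det_fin_three, restrictSlice_x]

theorem restrictSlice_γ₂ : restrictSlice (γ₂ hn) =
    C (MvPolynomial.X 1) * X * (X - C (MvPolynomial.X 0 * MvPolynomial.X 1)) := by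
  simp [γ₂, δ, restrictSlice_x]

theorem restrictSlice_α₂ : restrictSlice (α₂ hn) =
    C 1 * X ^ 2 + C (-(MvPolynomial.X 0 * MvPolynomial.X 1)) * X +
      C ((MvPolynomial.X 0 * MvPolynomial.X 1) ^ 2) := by
  simp only [α₂, map_add, map_sub, map_mul, map_pow, restrictSlice_β₂, restrictSlice_β₃, map_neg,
    map_one]
  ring

theorem restrictSlice_α₃ : restrictSlice (α₃ hn) =
    C 2 * X ^ 3 + C (-3 * (MvPolynomial.X 0 * MvPolynomial.X 1)) * X ^ 2 +
      C (-3 * (MvPolynomial.X 0 * MvPolynomial.X 1) ^ 2) * X +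
      C (2 * (MvPolynomial.X 0 * MvPolynomial.X 1) ^ 3) := by
  simp only [α₃, map_add, map_sub, map_mul, map_pow, restrictSlice_β₂, restrictSlice_β₃, map_neg,
    map_ofNat]
  ring

theorem leadingCoeff_restrictSlice_α₂ : (restrictSlice (α₂ hn)).leadingCoeff = 1 := by
  rw [restrictSlice_α₂, leadingCoeff_quadratic one_ne_zero]

theorem natDegree_restrictSlice_α₂ : (restrictSlice (α₂ hn)).natDegree = 2 := by
  rw [restrictSlice_α₂, natDegree_quadratic one_ne_zero]

theorem leadingCoeff_restrictSlice_α₃ : (restrictSlice (α₃ hn)).leadingCoeff = 2 := by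
  rw [restrictSlice_α₃, leadingCoeff_cubic two_ne_zero]

theorem natDegree_restrictSlice_α₃ : (restrictSlice (α₃ hn)).natDegree = 3 := by
  rw [restrictSlice_α₃, natDegree_cubic two_ne_zero]

theorem leadingCoeff_restrictSlice_γ₂ :
    (restrictSlice (γ₂ hn)).leadingCoeff = MvPolynomial.X 1 := by
  rw [restrictSlice_γ₂, leadingCoeff_mul, leadingCoeff_mul, leadingCoeff_C, leadingCoeff_X,
    leadingCoeff_X_sub_C, mul_one, mul_one]

theorem natDegree_restrictSlice_γ₂ : (restrictSlice (γ₂ hn)).natDegree = 2 := by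
  rw [restrictSlice_γ₂, natDegree_mul (mul_ne_zero (C_ne_zero.2 (MvPolynomial.X_ne_zero 1)) X_ne_zero)
    (X_sub_C_ne_zero _), natDegree_C_mul (MvPolynomial.X_ne_zero 1), natDegree_X,
    natDegree_X_sub_C]

theorem leadingCoeff_restrictSlice_genMonomial (a b c d e : ℕ) :
    (restrictSlice (genMonomial hn a b c d e)).leadingCoeff =
      MvPolynomial.monomial (Finsupp.single 0 a + Finsupp.single 1 (d + e) + Finsupp.single 2 d)
        (2 ^ c) := by
  simp only [genMonomial, map_mul, map_pow, leadingCoeff_mul, leadingCoeff_pow,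
    leadingCoeff_restrictSlice_α₂, leadingCoeff_restrictSlice_α₃, leadingCoeff_restrictSlice_γ₂,
    restrictSlice_α₁, restrictSlice_γ₁, leadingCoeff_C]
  have h2 : (2 : MvPolynomial (Fin 3) ℂ) = MvPolynomial.C 2 := (map_ofNat _ 2).symm
  rw [h2, ← mul_one (2 ^ c : ℂ), ← MvPolynomial.C_mul_monomial, map_pow]
  have hm (s t : Fin 3 →₀ ℕ) : MvPolynomial.monomial (s + t) (1 : ℂ) =
      MvPolynomial.monomial s 1 * MvPolynomial.monomial t 1 := by
    rw [MvPolynomial.monomial_mul, one_mul]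
  simp only [Finsupp.single_add, hm, ← MvPolynomial.X_pow_eq_monomial]
  ring

theorem natDegree_restrictSlice_genMonomial (a b c d e : ℕ) :
    (restrictSlice (genMonomial hn a b c d e)).natDegree = 2 * b + 3 * c + 2 * e := by
  have h0 : C (MvPolynomial.X (R := ℂ) (0 : Fin 3)) ≠ 0 := C_ne_zero.2 (MvPolynomial.X_ne_zero 0)
  have h1 : C (MvPolynomial.X (R := ℂ) (1 : Fin 3)) * C (MvPolynomial.X 2) ≠ 0 :=
    mul_ne_zero (C_ne_zero.2 (MvPolynomial.X_ne_zero 1)) (C_ne_zero.2 (MvPolynomial.X_ne_zero 2))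
  have h2 : restrictSlice (α₂ hn) ≠ 0 := fun h => by
    simpa [h] using natDegree_restrictSlice_α₂ hn
  have h3 : restrictSlice (α₃ hn) ≠ 0 := fun h => by
    simpa [h] using natDegree_restrictSlice_α₃ hn
  have h4 : restrictSlice (γ₂ hn) ≠ 0 := fun h => by
    simpa [h] using natDegree_restrictSlice_γ₂ hn
  simp only [genMonomial, map_mul, map_pow, restrictSlice_α₁, restrictSlice_γ₁]
  rw [natDegree_mul (mul_ne_zero (mul_ne_zero (mul_ne_zero (pow_ne_zero _ h0) (pow_ne_zero _ h2))
      (pow_ne_zero _ h3)) (pow_ne_zero _ h1)) (pow_ne_zero _ h4),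
    natDegree_mul (mul_ne_zero (mul_ne_zero (pow_ne_zero _ h0) (pow_ne_zero _ h2))
      (pow_ne_zero _ h3)) (pow_ne_zero _ h1),
    natDegree_mul (mul_ne_zero (pow_ne_zero _ h0) (pow_ne_zero _ h2)) (pow_ne_zero _ h3),
    natDegree_mul (pow_ne_zero _ h0) (pow_ne_zero _ h2)]
  simp only [natDegree_pow, natDegree_C, natDegree_restrictSlice_α₂, natDegree_restrictSlice_α₃,
    natDegree_restrictSlice_γ₂, ← C_mul]
  ring

theorem linearIndependent_genMonomial : LinearIndependent ℂ
    fun i : ℕ × ℕ × Fin 2 × ℕ × ℕ => genMonomial hn i.1 i.2.1 i.2.2.1 i.2.2.2.1 i.2.2.2.2 := by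
  refine LinearIndependent.of_comp (restrictSlice (n := n)).toLinearMap
    (linearIndependent_of_leadingCoeff_eq_monomial (fun i => pow_ne_zero _ two_ne_zero)
      (fun i => natDegree_restrictSlice_genMonomial hn _ _ _ _ _)
      (fun i => leadingCoeff_restrictSlice_genMonomial hn _ _ _ _ _) ?_)
  rintro ⟨a, b, c, d, e⟩ ⟨a', b', c', d', e'⟩ h
  simp only [Prod.mk.injEq, Finsupp.ext_iff] at h
  obtain ⟨hN, he⟩ := h
  have h0 : a = a' := by simpa using he 0
  have h1 : d + e = d' + e' := by simpa using he 1
  have h2 : d = d' := by simpa using he 2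
  -- The degree is 2b + 3c + 2e, so its parity determines c in {0, 1}; b follows.
  have hc : c = c' := by omega
  subst hc
  simp only [Prod.mk.injEq, true_and]
  omega

theorem linearIndependent_Binv : LinearIndependent ℂ (Binv hn) := by
  refine (linearIndependent_genMonomial hn).comp (fun i : InvIndex =>
    (i.1, i.2.1, i.2.2.1, 2 * i.2.2.2.1 + (i.2.2.2.2.2 : ℕ), 2 * i.2.2.2.2.1 + (i.2.2.2.2.2 : ℕ))) ?_
  rintro ⟨a, b, c, d, e, f⟩ ⟨a', b', c', d', e', f'⟩ h
  simp only [Prod.mk.injEq] at h ⊢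
  omega

theorem linearIndependent_Bsgn : LinearIndependent ℂ (Bsgn hn) := by
  have h := (linearIndependent_genMonomial hn).comp (fun i : SgnIndex ⊕ SgnIndex => match i with
    | Sum.inl (a, b, c, d, e) => (a, b, c, 2 * d + 1, 2 * e)
    | Sum.inr (a, b, c, d, e) => (a, b, c, 2 * d, 2 * e + 1)) ?_
  · convert h using 1
    funext i
    rcases i with ⟨a, b, c, d, e⟩ | ⟨a, b, c, d, e⟩ <;> rfl
  rintro (⟨a, b, c, d, e⟩ | ⟨a, b, c, d, e⟩) (⟨a', b', c', d', e'⟩ | ⟨a', b', c', d', e'⟩) h <;>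
    simp only [Prod.mk.injEq, Sum.inl.injEq, Sum.inr.injEq, reduceCtorEq] at h ⊢ <;> omega

end LinearIndependence

/-! ### Reduction of a generic matrix to normal form. -/

section Evaluation

open MvPolynomial (X C eval aeval bind₁)

variable {n : ℕ} (hn : 3 ≤ n)

theorem eval_x (M : Matrix (Fin n) (Fin 3) ℂ) (i j : Fin 3) :
    eval (fun p => M p.1 p.2) (x hn i j) = M (Fin.castLE hn i) j := by
  simp [x]

/-- The action substitutes gᵀX, so upper unitriangular g yields left multiplication by lower
unitriangular matrices. -/
theorem eval_unipotent_mul {f : P n 3} (hf : ∀ g ∈ U n, act g 1 f = f)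
    {L : Matrix (Fin n) (Fin n) ℂ} (hL : ∀ i j, i < j → L i j = 0) (hL1 : ∀ i, L i i = 1)
    (M : Matrix (Fin n) (Fin 3) ℂ) :
    eval (fun p => (L * M) p.1 p.2) f = eval (fun p => M p.1 p.2) f := by
  have hdet : L.transpose.det ≠ 0 := by
    have hT : L.transpose.BlockTriangular id := fun i j h => hL j i h
    rw [(Matrix.det_of_isUpperTriangular hT).trans (Finset.prod_eq_one fun i _ => hL1 i)]
    exact one_ne_zero
  have hg : Matrix.GeneralLinearGroup.mkOfDetNeZero L.transpose hdet ∈ U n :=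
    ⟨fun i j h => hL j i h, fun i => hL1 i⟩
  have h := eval_act (Matrix.GeneralLinearGroup.mkOfDetNeZero L.transpose hdet) 1 f M
  rw [hf _ hg] at h
  rw [h]
  simp [Matrix.GeneralLinearGroup.mkOfDetNeZero]

theorem eval_mul_diagonal {f : P n 3}
    (hf : ∀ t : Fin 3 → ℂˣ, ∏ j, (t j : ℂ) = 1 → act 1 (diagGL t) f = f)
    {t : Fin 3 → ℂ} (ht : ∏ j, t j = 1) (M : Matrix (Fin n) (Fin 3) ℂ) :
    eval (fun p => (M * Matrix.diagonal t) p.1 p.2) f = eval (fun p => M p.1 p.2) f := by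
  have h0 (j : Fin 3) : t j ≠ 0 := fun h =>
    one_ne_zero (ht.symm.trans (Finset.prod_eq_zero (Finset.mem_univ j) h))
  have h := eval_act 1 (diagGL fun j => Units.mk0 (t j) (h0 j)) f M
  rw [hf _ (by simpa using ht)] at h
  rw [h]
  simp [diagGL]

/-- The `n × 3` matrix with a given block of the first three rows and zeros below. -/
def padMatrix (n : ℕ) (Y : Matrix (Fin 3) (Fin 3) ℂ) : Matrix (Fin n) (Fin 3) ℂ :=
  Matrix.of fun i k => if h : i.val < 3 then Y ⟨i.val, h⟩ k else 0

theorem padMatrix_castLE (Y : Matrix (Fin 3) (Fin 3) ℂ) (i k : Fin 3) :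
    padMatrix n Y (Fin.castLE hn i) k = Y i k := by
  simp [padMatrix]

theorem eval_padMatrix_x (Y : Matrix (Fin 3) (Fin 3) ℂ) (i j : Fin 3) :
    eval (fun p => padMatrix n Y p.1 p.2) (x hn i j) = Y i j := by
  rw [eval_x, padMatrix_castLE]

theorem mul_padMatrix_apply (L : Matrix (Fin n) (Fin n) ℂ) (Y : Matrix (Fin 3) (Fin 3) ℂ)
    (i : Fin n) (k : Fin 3) :
    (L * padMatrix n Y) i k = ∑ j : Fin 3, L i (Fin.castLE hn j) * Y j k := by
  rw [Matrix.mul_apply, sum_eq_sum_castLE hn]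
  · simp only [padMatrix_castLE]
  · intro s hs
    simp [padMatrix, Nat.not_lt.2 hs]

/-- The normal form of a generic matrix under row operations and column scaling. -/
abbrev normalForm (s a b c : ℂ) : Matrix (Fin 3) (Fin 3) ℂ :=
  !![1, 1, s; 0, a, b; 0, 0, c]

/-- An explicit factorization of M as lower unitriangular times normal form times diagonal of
determinant 1; f does not see the outer factors. -/
theorem eval_eq_eval_normalForm {f : P n 3} (hU : ∀ g ∈ U n, act g 1 f = f)
    (hT : ∀ t : Fin 3 → ℂˣ, ∏ j, (t j : ℂ) = 1 → act 1 (diagGL t) f = f)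
    (M : Matrix (Fin n) (Fin 3) ℂ) {v₁ v₂ v₃ w : ℂ}
    (h₁ : eval (fun p => M p.1 p.2) (α₁ hn) = v₁) (h₂ : eval (fun p => M p.1 p.2) (β₂ hn) = v₂)
    (h₃ : eval (fun p => M p.1 p.2) (β₃ hn) = v₃) (hw : eval (fun p => M p.1 p.2) (γ₁ hn) = w)
    (hv₁ : v₁ ≠ 0) (hv₂ : v₂ ≠ 0) (hw₀ : w ≠ 0) :
    eval (fun p => M p.1 p.2) f =
      eval (fun p => padMatrix n (normalForm v₁ (v₂ / v₁) v₃ (w * v₁ / v₂)) p.1 p.2) f := by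
  simp only [α₁, β₂, β₃, γ₁, δ, Matrix.det_fin_two_of, Matrix.det_fin_three, Matrix.of_apply,
    map_mul, map_sub, map_add, eval_x] at h₁ h₂ h₃ hw
  set x0 := M (Fin.castLE hn 0) 0
  set x1 := M (Fin.castLE hn 0) 1
  set x2 := M (Fin.castLE hn 0) 2
  set y0 := M (Fin.castLE hn 1) 0
  set y1 := M (Fin.castLE hn 1) 1
  set y2 := M (Fin.castLE hn 1) 2
  set z0 := M (Fin.castLE hn 2) 0
  set z1 := M (Fin.castLE hn 2) 1
  set z2 := M (Fin.castLE hn 2) 2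
  have hx0 : x0 ≠ 0 := by rintro h; simp [h] at h₁; exact hv₁ h₁.symm
  have hx1 : x1 ≠ 0 := by rintro h; simp [h] at h₁; exact hv₁ h₁.symm
  set a := v₂ / v₁ with ha
  set c := w * v₁ / v₂ with hc
  have ha0 : a ≠ 0 := div_ne_zero hv₂ hv₁
  have hc0 : c ≠ 0 := div_ne_zero (mul_ne_zero hw₀ hv₁) hv₂
  have hax : a * (x0 * x1) = x0 * y1 - x1 * y0 := by
    rw [ha, div_mul_eq_mul_div, div_eq_iff hv₁, ← h₁, ← h₂]
    ring
  have hac : a * c = w := by rw [ha, hc]; field_simp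
  -- The first three columns of L, found by solving M = L · (normal form) · diag(x0, x1, 1/(x0 x1))
  -- column by column. The other columns of L are those of the identity, since they meet only zero
  -- rows.
  let K : Fin n → Fin 3 → ℂ := fun i => ![M i 0 / x0, (M i 1 / x1 - M i 0 / x0) / a,
    (M i 2 * (x0 * x1) - v₁ * (M i 0 / x0) - v₃ * ((M i 1 / x1 - M i 0 / x0) / a)) / c]
  let L : Matrix (Fin n) (Fin n) ℂ := Matrix.of fun i j =>
    if h : j.val < 3 then K i ⟨j.val, h⟩ else if i = j then 1 else 0
  have k00 : K (Fin.castLE hn 0) 0 = 1 := div_self hx0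
  have k01 : K (Fin.castLE hn 0) 1 = 0 := by
    change (x1 / x1 - x0 / x0) / a = 0
    rw [div_self hx0, div_self hx1, sub_self, zero_div]
  have k02 : K (Fin.castLE hn 0) 2 = 0 := by
    change (x2 * (x0 * x1) - v₁ * (x0 / x0) - v₃ * ((x1 / x1 - x0 / x0) / a)) / c = 0
    rw [div_self hx0, div_self hx1, ← h₁]
    ring
  have hk11 : (y1 / x1 - y0 / x0) / a = 1 := by
    rw [div_eq_one_iff_eq ha0]
    field_simp
    linear_combination -hax
  have k11 : K (Fin.castLE hn 1) 1 = 1 := hk11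
  have k12 : K (Fin.castLE hn 1) 2 = 0 := by
    change (y2 * (x0 * x1) - v₁ * (y0 / x0) - v₃ * ((y1 / x1 - y0 / x0) / a)) / c = 0
    rw [hk11, ← h₁, ← h₃, div_eq_zero_iff]
    left
    field_simp
    ring
  have k22 : K (Fin.castLE hn 2) 2 = 1 := by
    change (z2 * (x0 * x1) - v₁ * (z0 / x0) - v₃ * ((z1 / x1 - z0 / x0) / a)) / c = 1
    rw [div_eq_one_iff_eq hc0]
    apply mul_left_cancel₀ (mul_ne_zero ha0 (mul_ne_zero hx0 hx1))
    have e1 : a * (x0 * x1) * (z2 * (x0 * x1) - v₁ * (z0 / x0) -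
        v₃ * ((z1 / x1 - z0 / x0) / a)) =
        a * (x0 * x1) * (z2 * (x0 * x1)) - a * (x0 * x1) * (v₁ / x0) * z0 -
          v₃ * (x0 * z1 - x1 * z0) := by
      field_simp
    have e2 : v₁ / x0 = x1 * x2 := by rw [← h₁]; field_simp
    rw [e1, e2]
    linear_combination (z2 * (x0 * x1) - x1 * x2 * z0) * hax + (x0 * x1) * hw - (x0 * x1) * hac + (x0 * z1 - x1 * z0) * h₃
  have hcast (j : Fin n) (hj : j.val < 3) : ∃ j' : Fin 3, j = Fin.castLE hn j' := ⟨⟨j, hj⟩, rfl⟩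
  have hLK (i : Fin n) (j : Fin 3) : L i (Fin.castLE hn j) = K i j := by simp [L]
  have hL0 (i j : Fin n) (hij : i < j) : L i j = 0 := by
    by_cases hj : j.val < 3
    · obtain ⟨i, rfl⟩ := hcast i (lt_trans hij hj)
      obtain ⟨j, rfl⟩ := hcast j hj
      rw [hLK]
      fin_cases i <;> fin_cases j <;> first | exact k01 | exact k02 | exact k12 |
        exact absurd hij (by simp [Fin.lt_def])
    · simp [L, hj, hij.ne]
  have hL1 (i : Fin n) : L i i = 1 := by
    by_cases hi : i.val < 3
    · obtain ⟨i, rfl⟩ := hcast i hi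
      rw [hLK]
      fin_cases i
      exacts [k00, k11, k22]
    · simp [L, hi]
  have hM : M = L * padMatrix n (normalForm v₁ a v₃ c) *
      Matrix.diagonal ![x0, x1, (x0 * x1)⁻¹] := by
    ext i k
    rw [Matrix.mul_diagonal, mul_padMatrix_apply hn, Fin.sum_univ_three, hLK, hLK, hLK]
    fin_cases k <;> simp [K] <;> field_simp <;> ring
  conv_lhs => rw [hM]
  rw [eval_mul_diagonal hT (by simp [Fin.prod_univ_three]; field_simp),
    eval_unipotent_mul hU hL0 hL1]

/-- Clearing denominators: if d clears each coordinate, a power of d clears any polynomial in them.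
-/
theorem exists_pow_mul_eval_eq {σ τ : Type*} (d : MvPolynomial τ ℂ) (w : σ → (τ → ℂ) → ℂ)
    (hw : ∀ p, ∃ q : MvPolynomial τ ℂ, ∀ v, eval v d ≠ 0 → eval v d * w p v = eval v q)
    (f : MvPolynomial σ ℂ) : ∃ (N : ℕ) (H : MvPolynomial τ ℂ), ∀ v, eval v d ≠ 0 →
      eval v d ^ N * eval (fun p => w p v) f = eval v H := by
  induction f using MvPolynomial.induction_on with
  | C r => exact ⟨0, C r, fun v _ => by simp⟩
  | add f f' h h' =>
    obtain ⟨N, H, h⟩ := h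
    obtain ⟨N', H', h'⟩ := h'
    refine ⟨N + N', d ^ N' * H + d ^ N * H', fun v hv => ?_⟩
    simp only [map_add, map_mul, map_pow, ← h v hv, ← h' v hv]
    ring
  | mul_X f p h =>
    obtain ⟨N, H, h⟩ := h
    obtain ⟨q, hq⟩ := hw p
    refine ⟨N + 1, H * q, fun v hv => ?_⟩
    simp only [map_mul, ← h v hv, ← hq v hv, MvPolynomial.eval_X]
    ring

/-- The elements `α₁, β₂, β₃, γ₁, γ₂`. -/
def gens : Fin 5 → P n 3 := ![α₁ hn, β₂ hn, β₃ hn, γ₁ hn, γ₂ hn]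

theorem eval_aeval_gens (M : Matrix (Fin n) (Fin 3) ℂ) (H : MvPolynomial (Fin 5) ℂ) :
    eval (fun p => M p.1 p.2) (aeval (gens hn) H) =
      eval (fun i => eval (fun p => M p.1 p.2) (gens hn i)) H := by
  rw [MvPolynomial.aeval_def, MvPolynomial.eval_eval₂]
  change MvPolynomial.eval₂ _ _ H = MvPolynomial.eval₂ _ _ H
  congr 1
  ext z
  simp

/-- The algebra generated by `α₁, β₂, β₃, γ₁, γ₂`. -/
def genAlg : Subalgebra ℂ (P n 3) := (aeval (gens hn)).range

theorem α₁_ne_zero : α₁ hn ≠ 0 := fun h => by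
  have h' := restrictSlice_α₁ hn
  rw [h, map_zero] at h'
  exact Polynomial.C_ne_zero.2 (MvPolynomial.X_ne_zero 0) h'.symm

theorem β₂_ne_zero : β₂ hn ≠ 0 := fun h => by
  have h' := restrictSlice_β₂ hn
  rw [h, map_zero] at h'
  exact Polynomial.C_ne_zero.2 (mul_ne_zero (MvPolynomial.X_ne_zero 0) (MvPolynomial.X_ne_zero 1)) h'.symm

theorem γ₁_ne_zero : γ₁ hn ≠ 0 := fun h => by
  have h' := restrictSlice_γ₁ hn
  rw [h, map_zero] at h'
  exact Polynomial.C_ne_zero.2 (mul_ne_zero (MvPolynomial.X_ne_zero 1) (MvPolynomial.X_ne_zero 2)) h'.symm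

theorem exists_pow_mul_mem_genAlg {f : P n 3} (hU : ∀ g ∈ U n, act g 1 f = f)
    (hT : ∀ t : Fin 3 → ℂˣ, ∏ j, (t j : ℂ) = 1 → act 1 (diagGL t) f = f) :
    ∃ N, (α₁ hn * β₂ hn) ^ N * f ∈ genAlg hn := by
  obtain ⟨N, H, hH⟩ := exists_pow_mul_eval_eq (X 0 * X 1 : MvPolynomial (Fin 5) ℂ)
    (fun (p : Fin n × Fin 3) v =>
      padMatrix n (normalForm (v 0) (v 1 / v 0) (v 2) (v 3 * v 0 / v 1)) p.1 p.2) (by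
      rintro ⟨i, k⟩
      -- The normal form multiplied by α₁β₂, written in the variables 0, 1, 2, 3 standing for α₁,
      -- β₂, β₃, γ₁.
      refine ⟨if h : i.val < 3 then
        !![X 0 * X 1, X 0 * X 1, X 0 ^ 2 * X 1; 0, X 1 ^ 2, X 0 * X 1 * X 2; 0, 0, X 3 * X 0 ^ 2]
          ⟨i.val, h⟩ k else 0, fun v hv => ?_⟩
      simp only [map_mul, MvPolynomial.eval_X, ne_eq, mul_eq_zero, not_or] at hv ⊢
      obtain ⟨h0, h1⟩ := hv
      by_cases hi : i.val < 3
      · obtain ⟨j, rfl⟩ : ∃ j : Fin 3, i = Fin.castLE hn j := ⟨⟨i, hi⟩, rfl⟩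
        rw [padMatrix_castLE, dif_pos hi]
        fin_cases j <;> fin_cases k <;> simp <;> field_simp
      · simp [padMatrix, hi]) f
  refine ⟨N, H, ?_⟩
  change aeval (gens hn) H = _
  -- The extra factor makes the identity trivial at matrices where the normal form is unavailable.
  apply mul_left_cancel₀ (mul_ne_zero (mul_ne_zero (α₁_ne_zero hn) (β₂_ne_zero hn))
    (γ₁_ne_zero hn))
  apply MvPolynomial.funext
  intro M
  obtain ⟨M, rfl⟩ : ∃ M' : Matrix (Fin n) (Fin 3) ℂ, M = fun p => M' p.1 p.2 :=
    ⟨Matrix.of fun i j => M (i, j), rfl⟩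
  rw [map_mul, map_mul _ _ ((α₁ hn * β₂ hn) ^ N * f), eval_aeval_gens]
  by_cases h : eval (fun p => M p.1 p.2) (α₁ hn * β₂ hn * γ₁ hn) = 0
  · rw [h, zero_mul, zero_mul]
  congr 1
  simp only [map_mul, mul_eq_zero, not_or] at h
  obtain ⟨⟨h1, h2⟩, h3⟩ := h
  rw [← hH _ (by simpa [gens] using ⟨h1, h2⟩), map_mul _ ((α₁ hn * β₂ hn) ^ N) f,
    eval_eq_eval_normalForm hn hU hT M rfl rfl rfl rfl h1 h2 h3]
  simp [gens]

end Evaluation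

/-! ### Cancelling α₁ and β₂ inside the generated algebra. -/

section Saturation

open MvPolynomial (X C eval aeval bind₁)

theorem X_sub_dvd_sub_bind₁ {σ : Type*} [DecidableEq σ] (i : σ) (p H : MvPolynomial σ ℂ) :
    X i - p ∣ H - bind₁ (Function.update X i p) H := by
  have h : (Ideal.Quotient.mkₐ ℂ (Ideal.span {X i - p})).comp (bind₁ (Function.update X i p)) =
      Ideal.Quotient.mkₐ ℂ (Ideal.span {X i - p}) := by
    apply MvPolynomial.algHom_ext
    intro j
    rw [AlgHom.comp_apply, MvPolynomial.bind₁_X_right]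
    by_cases hj : j = i
    · subst hj
      rw [Function.update_self, Ideal.Quotient.mkₐ_eq_mk, Eq.comm, Ideal.Quotient.eq]
      exact Ideal.mem_span_singleton_self _
    · rw [Function.update_of_ne hj]
  rw [← Ideal.mem_span_singleton, ← Ideal.Quotient.eq]
  exact (DFunLike.congr_fun h H).symm

theorem eval_bind₁_update {σ : Type*} [DecidableEq σ] (i : σ) (p H : MvPolynomial σ ℂ)
    (v : σ → ℂ) : eval v (bind₁ (Function.update X i p) H) =
      eval (Function.update v i (eval v p)) H := by
  rw [← MvPolynomial.coe_aeval_eq_eval, RingHom.coe_coe, MvPolynomial.aeval_bind₁,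
    MvPolynomial.aeval_eq_eval]
  congr 2
  funext j
  by_cases hj : j = i
  · subst hj
    simp [MvPolynomial.aeval_eq_eval]
  · simp [Function.update_of_ne hj]

/-- It suffices that H vanish on the part of the graph X i = p where R ≠ 0, which is dense: after
substituting p for X i, the product H · R vanishes identically while R does not. -/
theorem X_sub_dvd_of_eval_eq_zero {σ : Type*} [DecidableEq σ] (i : σ) (p R : MvPolynomial σ ℂ)
    {H : MvPolynomial σ ℂ} (hp : ∀ v c, eval (Function.update v i c) p = eval v p)
    (hR : ∃ v, v i = eval v p ∧ eval v R ≠ 0)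
    (hH : ∀ v, v i = eval v p → eval v R ≠ 0 → eval v H = 0) : X i - p ∣ H := by
  have hR' : bind₁ (Function.update X i p) R ≠ 0 := by
    obtain ⟨v, hv, hvR⟩ := hR
    intro h
    apply hvR
    have h' := eval_bind₁_update i p R v
    rw [h, map_zero, ← hv, Function.update_eq_self] at h'
    exact h'.symm
  have hH' : bind₁ (Function.update X i p) H = 0 := by
    refine (mul_eq_zero.1 (MvPolynomial.funext fun v => ?_)).resolve_right hR'
    rw [map_mul, map_zero, eval_bind₁_update, eval_bind₁_update, mul_eq_zero, or_iff_not_imp_right]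
    exact hH _ (by rw [Function.update_self, hp])
  simpa [hH'] using X_sub_dvd_sub_bind₁ i p H

theorem X_dvd_of_eval_eq_zero {σ : Type*} [DecidableEq σ] (i : σ) (R : MvPolynomial σ ℂ)
    {H : MvPolynomial σ ℂ} (hR : ∃ v, v i = 0 ∧ eval v R ≠ 0)
    (hH : ∀ v, v i = 0 → eval v R ≠ 0 → eval v H = 0) : X i ∣ H := by
  simpa using X_sub_dvd_of_eval_eq_zero (H := H) i 0 R (by simp) (by simpa using hR)
    (by simpa using hH)

variable {n : ℕ} (hn : 3 ≤ n)

theorem eval_eq_zero_of_padMatrix {g K : P n 3} {H : MvPolynomial (Fin 5) ℂ}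
    (hK : g * K = aeval (gens hn) H) (Y : Matrix (Fin 3) (Fin 3) ℂ)
    (hg : eval (fun p => padMatrix n Y p.1 p.2) g = 0) {v : Fin 5 → ℂ}
    (hv : ∀ i, eval (fun p => padMatrix n Y p.1 p.2) (gens hn i) = v i) : eval v H = 0 := by
  have h := congrArg (eval fun p => padMatrix n Y p.1 p.2) hK
  rw [map_mul, hg, zero_mul, eval_aeval_gens] at h
  rw [h]
  congr 2
  funext i
  exact (hv i).symm

theorem α₁_mul_γ₂ : α₁ hn * γ₂ hn = β₂ hn * β₃ hn * (β₃ hn - β₂ hn) := by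
  simp only [α₁, γ₂, β₂, β₃, δ, Matrix.det_fin_two_of]
  ring

/-- The matrices have x₁₃ = 0, which kills both α₁ and β₂; the lemma therefore serves both
cancellations. -/
theorem eval_eq_zero_of_third {g K : P n 3} {H : MvPolynomial (Fin 5) ℂ}
    (hK : g * K = aeval (gens hn) H)
    (hg : ∀ y z w, eval (fun p => padMatrix n !![1, 1, 0; 0, y, z; 0, w, 0] p.1 p.2) g = 0)
    (v : Fin 5 → ℂ) (h0 : v 0 = 0) (h1 : v 1 = 0) (h2 : v 2 ≠ 0) : eval v H = 0 := by
  refine eval_eq_zero_of_padMatrix hn hK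
    !![1, 1, 0; 0, v 4 / v 2 ^ 2, v 2; 0, -v 3 / v 2, 0] (hg _ _ _) fun i => ?_
  fin_cases i <;>
    simp [gens, α₁, β₂, β₃, γ₁, γ₂, δ, Matrix.det_fin_three, eval_padMatrix_x, h0, h1]
  all_goals field_simp

/-- Where α₁ = 0, the relation leaves three components β₂ = 0, β₃ = 0, β₂ = β₃. They are reached by
matrices with x₁₃, x₁₂ or x₁₁ zero, on which the remaining generators take prescribed values. Hence
H modulo X 0 is divisible by X 1 · X 2 · (X 2 - X 1), and the relation turns that product into α₁γ₂.
-/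
theorem mem_genAlg_of_α₁_mul_mem {K : P n 3} (hK : α₁ hn * K ∈ genAlg hn) : K ∈ genAlg hn := by
  obtain ⟨H, hH⟩ := hK
  replace hH : α₁ hn * K = aeval (gens hn) H := hH.symm
  have v1 (v : Fin 5 → ℂ) (h0 : v 0 = 0) (h12 : v 2 = v 1) (h1 : v 1 ≠ 0) : eval v H = 0 := by
    refine eval_eq_zero_of_padMatrix hn hH
      !![0, 1, 1; -v 1, 0, v 4 / v 1 ^ 2; 0, 0, v 3 / v 1]
      (by simp [α₁, eval_padMatrix_x]) fun i => ?_
    fin_cases i <;>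
      simp [gens, α₁, β₂, β₃, γ₁, γ₂, δ, Matrix.det_fin_three, eval_padMatrix_x, h0, h12]
    all_goals field_simp
  have v2 (v : Fin 5 → ℂ) (h0 : v 0 = 0) (h2 : v 2 = 0) (h1 : v 1 ≠ 0) : eval v H = 0 := by
    refine eval_eq_zero_of_padMatrix hn hH
      !![1, 0, 1; 0, v 1, -v 4 / v 1 ^ 2; 0, 0, v 3 / v 1]
      (by simp [α₁, eval_padMatrix_x]) fun i => ?_
    fin_cases i <;>
      simp [gens, α₁, β₂, β₃, γ₁, γ₂, δ, Matrix.det_fin_three, eval_padMatrix_x, h0, h2]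
    all_goals field_simp
  have v3 := eval_eq_zero_of_third hn hH fun y z w => by simp [α₁, eval_padMatrix_x]
  obtain ⟨H₁, hH₁⟩ := X_sub_dvd_sub_bind₁ 0 0 H
  set H₀ := bind₁ (Function.update X 0 0) H with hH₀
  have e₀ (v : Fin 5 → ℂ) : eval v H₀ = eval (Function.update v 0 0) H := by
    rw [hH₀, eval_bind₁_update, map_zero]
  obtain ⟨H₂, hH₂⟩ : X 1 ∣ H₀ := by
    refine X_dvd_of_eval_eq_zero 1 (X 2) ⟨fun i => if i = 2 then 1 else 0, by simp⟩
      fun v h1 h2 => ?_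
    rw [MvPolynomial.eval_X] at h2
    rw [e₀]
    exact v3 _ (by simp) (by simpa using h1) (by simpa using h2)
  obtain ⟨H₃, hH₃⟩ : X 2 ∣ H₂ := by
    refine X_dvd_of_eval_eq_zero 2 (X 1) ⟨fun i => if i = 1 then 1 else 0, by simp⟩
      fun v h2 h1 => ?_
    rw [MvPolynomial.eval_X] at h1
    have h := e₀ v
    rw [hH₂, map_mul, MvPolynomial.eval_X,
      v2 _ (by simp) (by simpa using h2) (by simpa using h1)] at h
    exact (mul_eq_zero.1 h).resolve_left h1
  obtain ⟨H₄, hH₄⟩ : X 2 - X 1 ∣ H₃ := by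
    refine X_sub_dvd_of_eval_eq_zero 2 (X 1) (X 1) (fun v c => by simp) ⟨fun _ => 1, by simp⟩
      fun v h2 h1 => ?_
    rw [MvPolynomial.eval_X] at h1 h2
    have h := e₀ v
    rw [hH₂, hH₃, map_mul, map_mul, MvPolynomial.eval_X, MvPolynomial.eval_X, h2,
      v1 _ (by simp) (by simpa using h2) (by simpa using h1)] at h
    exact (mul_eq_zero.1 ((mul_eq_zero.1 h).resolve_left h1)).resolve_left h1
  refine ⟨H₁ + X 4 * H₄, mul_left_cancel₀ (α₁_ne_zero hn) ?_⟩
  change α₁ hn * aeval (gens hn) (H₁ + X 4 * H₄) = _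
  have hHe : H = X 0 * H₁ + X 1 * X 2 * (X 2 - X 1) * H₄ := by
    rw [sub_eq_iff_eq_add, hH₂, hH₃, hH₄] at hH₁
    rw [hH₁]
    ring
  rw [hH, hHe]
  have g0 : gens hn 0 = α₁ hn := rfl
  have g1 : gens hn 1 = β₂ hn := rfl
  have g2 : gens hn 2 = β₃ hn := rfl
  have g4 : gens hn 4 = γ₂ hn := rfl
  simp only [map_add, map_mul, map_sub, MvPolynomial.aeval_X, g0, g1, g2, g4]
  linear_combination (aeval (gens hn) H₄) * α₁_mul_γ₂ hn

/-- Where β₂ = 0, the relation leaves the components α₁ = 0 and γ₂ = 0, reached by x₁₃ = 0 and δ₁₂ =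
0. Hence H modulo X 1 is divisible by X 0 · X 4, and α₁γ₂ is a multiple of β₂. -/
theorem mem_genAlg_of_β₂_mul_mem {K : P n 3} (hK : β₂ hn * K ∈ genAlg hn) : K ∈ genAlg hn := by
  obtain ⟨H, hH⟩ := hK
  replace hH : β₂ hn * K = aeval (gens hn) H := hH.symm
  have v1 (v : Fin 5 → ℂ) (h1 : v 1 = 0) (h4 : v 4 = 0) (h2 : v 2 ≠ 0) : eval v H = 0 := by
    refine eval_eq_zero_of_padMatrix hn hH
      !![1, 1, v 0; 0, 0, v 2; 0, -v 3 / v 2, 0]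
      (by simp [β₂, δ, eval_padMatrix_x]) fun i => ?_
    fin_cases i <;>
      simp [gens, α₁, β₂, β₃, γ₁, γ₂, δ, Matrix.det_fin_three, eval_padMatrix_x, h1, h4]
    all_goals field_simp
  have v3 := eval_eq_zero_of_third hn hH fun y z w => by simp [β₂, δ, eval_padMatrix_x]
  obtain ⟨H₁, hH₁⟩ := X_sub_dvd_sub_bind₁ 1 0 H
  set H₀ := bind₁ (Function.update X 1 0) H with hH₀
  have e₀ (v : Fin 5 → ℂ) : eval v H₀ = eval (Function.update v 1 0) H := by
    rw [hH₀, eval_bind₁_update, map_zero]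
  obtain ⟨H₂, hH₂⟩ : X 0 ∣ H₀ := by
    refine X_dvd_of_eval_eq_zero 0 (X 2) ⟨fun i => if i = 2 then 1 else 0, by simp⟩
      fun v h0 h2 => ?_
    rw [MvPolynomial.eval_X] at h2
    rw [e₀]
    exact v3 _ (by simpa using h0) (by simp) (by simpa using h2)
  obtain ⟨H₃, hH₃⟩ : X 4 ∣ H₂ := by
    refine X_dvd_of_eval_eq_zero 4 (X 0 * X 2) ⟨fun i => if i = 4 then 0 else 1, by simp⟩
      fun v h4 h02 => ?_
    simp only [map_mul, MvPolynomial.eval_X, ne_eq, mul_eq_zero, not_or] at h02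
    have h := e₀ v
    rw [hH₂, map_mul, MvPolynomial.eval_X,
      v1 _ (by simp) (by simpa using h4) (by simpa using h02.2)] at h
    exact (mul_eq_zero.1 h).resolve_left h02.1
  refine ⟨H₁ + X 2 * (X 2 - X 1) * H₃, mul_left_cancel₀ (β₂_ne_zero hn) ?_⟩
  change β₂ hn * aeval (gens hn) (H₁ + X 2 * (X 2 - X 1) * H₃) = _
  have hHe : H = X 1 * H₁ + X 0 * X 4 * H₃ := by
    rw [sub_eq_iff_eq_add, hH₂, hH₃] at hH₁
    rw [hH₁]
    ring
  rw [hH, hHe]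
  have g0 : gens hn 0 = α₁ hn := rfl
  have g1 : gens hn 1 = β₂ hn := rfl
  have g2 : gens hn 2 = β₃ hn := rfl
  have g4 : gens hn 4 = γ₂ hn := rfl
  simp only [map_add, map_mul, map_sub, MvPolynomial.aeval_X, g0, g1, g2, g4]
  linear_combination -(aeval (gens hn) H₃) * α₁_mul_γ₂ hn

theorem mem_genAlg_of_pow_mul_mem {K : P n 3} (N : ℕ) (hK : (α₁ hn * β₂ hn) ^ N * K ∈ genAlg hn) :
    K ∈ genAlg hn := by
  induction N with
  | zero => simpa using hK
  | succ N ih =>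
    apply ih
    apply mem_genAlg_of_β₂_mul_mem hn
    apply mem_genAlg_of_α₁_mul_mem hn
    rw [pow_succ] at hK
    convert hK using 1
    ring

theorem mem_genAlg_of_mem_Q {f : P n 3} (hQ : f ∈ Q n 3) (hU : ∀ g ∈ U n, act g 1 f = f) :
    f ∈ genAlg hn := by
  obtain ⟨N, hN⟩ := exists_pow_mul_mem_genAlg hn hU (act_diagGL_of_mem_Q hQ)
  exact mem_genAlg_of_pow_mul_mem hn N hN

end Saturation

/-! ### Averaging over S₃ and reduction to the bases. -/

section Spanning

open MvPolynomial (X C eval aeval bind₁)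

variable {n : ℕ} (hn : 3 ≤ n)

theorem α₃_sq : α₃ hn ^ 2 = 4 * α₂ hn ^ 3 - 27 * (α₁ hn ^ 2 * γ₂ hn ^ 2) := by
  rw [← mul_pow, α₁_mul_γ₂, α₂, α₃]
  ring

/-- The discriminant relation lowers the exponent of α₃ by 2 and changes that of γ₂ by 0 or 2, so
the parity is kept. -/
theorem genMonomial_mem_of_lt_two {W : Submodule ℂ (P n 3)} {ε : ℕ}
    (h : ∀ a b c d e, c < 2 → (d + e) % 2 = ε → genMonomial hn a b c d e ∈ W) (c : ℕ) :
    ∀ a b d e, (d + e) % 2 = ε → genMonomial hn a b c d e ∈ W := by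
  induction c using Nat.twoStepInduction with
  | zero => exact fun a b d e => h a b 0 d e (by norm_num)
  | one => exact fun a b d e => h a b 1 d e (by norm_num)
  | more c ih _ =>
    intro a b d e hde
    have hrel : genMonomial hn a b (c + 2) d e = (4 : ℂ) • genMonomial hn a (b + 3) c d e -
        (27 : ℂ) • genMonomial hn (a + 2) b c d (e + 2) := by
      simp only [genMonomial, MvPolynomial.smul_eq_C_mul, map_ofNat]
      linear_combination (α₁ hn ^ a * α₂ hn ^ b * α₃ hn ^ c * γ₁ hn ^ d * γ₂ hn ^ e) * α₃_sq hn
    rw [hrel]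
    exact sub_mem (Submodule.smul_mem _ _ (ih _ _ _ _ hde))
      (Submodule.smul_mem _ _ (ih _ _ _ _ (by omega)))

theorem genMonomial_mem_span_Binv {a b c d e : ℕ} (h : (d + e) % 2 = 0) :
    genMonomial hn a b c d e ∈ Submodule.span ℂ (Set.range (Binv hn)) := by
  refine genMonomial_mem_of_lt_two hn (fun a b c d e hc hde => Submodule.subset_span ?_) c a b d e h
  -- The last index is the common parity of d and e.
  refine ⟨(a, b, ⟨c, hc⟩, d / 2, e / 2, ⟨d % 2, Nat.mod_lt _ two_pos⟩), ?_⟩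
  change genMonomial hn a b c (2 * (d / 2) + d % 2) (2 * (e / 2) + d % 2) = _
  congr 1 <;> omega

theorem genMonomial_mem_span_Bsgn {a b c d e : ℕ} (h : (d + e) % 2 = 1) :
    genMonomial hn a b c d e ∈ Submodule.span ℂ (Set.range (Bsgn hn)) := by
  refine genMonomial_mem_of_lt_two hn (fun a b c d e hc hde => Submodule.subset_span ?_) c a b d e h
  rcases Nat.mod_two_eq_zero_or_one d with hd | hd
  · refine ⟨Sum.inr (a, b, ⟨c, hc⟩, d / 2, e / 2), ?_⟩
    change genMonomial hn a b c (2 * (d / 2)) (2 * (e / 2) + 1) = _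
    congr 1 <;> omega
  · refine ⟨Sum.inl (a, b, ⟨c, hc⟩, d / 2, e / 2), ?_⟩
    change genMonomial hn a b c (2 * (d / 2) + 1) (2 * (e / 2)) = _
    congr 1 <;> omega

theorem α₂_mul_mem_span_Binv {p : P n 3} (hp : p ∈ Submodule.span ℂ (Set.range (Binv hn))) :
    α₂ hn * p ∈ Submodule.span ℂ (Set.range (Binv hn)) := by
  induction hp using Submodule.span_induction with
  | mem p hp =>
    obtain ⟨⟨a, b, c, d, e, f⟩, rfl⟩ := hp
    refine Submodule.subset_span ⟨(a, b + 1, c, d, e, f), ?_⟩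
    simp only [Binv]
    ring
  | zero => simp
  | add p q _ _ hp hq => rw [mul_add]; exact add_mem hp hq
  | smul z p _ hp => rw [mul_smul_comm]; exact Submodule.smul_mem _ z hp

theorem α₂_mul_mem_span_Bsgn {p : P n 3} (hp : p ∈ Submodule.span ℂ (Set.range (Bsgn hn))) :
    α₂ hn * p ∈ Submodule.span ℂ (Set.range (Bsgn hn)) := by
  induction hp using Submodule.span_induction with
  | mem p hp =>
    obtain ⟨⟨a, b, c, d, e⟩ | ⟨a, b, c, d, e⟩, rfl⟩ := hp
    · refine Submodule.subset_span ⟨Sum.inl (a, b + 1, c, d, e), ?_⟩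
      simp only [Bsgn]
      ring
    · refine Submodule.subset_span ⟨Sum.inr (a, b + 1, c, d, e), ?_⟩
      simp only [Bsgn]
      ring
  | zero => simp
  | add p q _ _ hp hq => rw [mul_add]; exact add_mem hp hq
  | smul z p _ hp => rw [mul_smul_comm]; exact Submodule.smul_mem _ z hp

/-- The algebra generated by `α₁, α₂, α₃, γ₁, γ₂`. -/
def symAlg : Subalgebra ℂ (P n 3) :=
  (aeval (![α₁ hn, α₂ hn, α₃ hn, γ₁ hn, γ₂ hn] : Fin 5 → P n 3)).range

theorem α₁_mem_symAlg : α₁ hn ∈ symAlg hn := ⟨X 0, MvPolynomial.aeval_X _ _⟩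
theorem α₂_mem_symAlg : α₂ hn ∈ symAlg hn := ⟨X 1, MvPolynomial.aeval_X _ _⟩
theorem α₃_mem_symAlg : α₃ hn ∈ symAlg hn := ⟨X 2, MvPolynomial.aeval_X _ _⟩
theorem γ₁_mem_symAlg : γ₁ hn ∈ symAlg hn := ⟨X 3, MvPolynomial.aeval_X _ _⟩
theorem γ₂_mem_symAlg : γ₂ hn ∈ symAlg hn := ⟨X 4, MvPolynomial.aeval_X _ _⟩

theorem exists_add_of_mem_symAlg {r : P n 3} (hr : r ∈ symAlg hn) :
    ∃ p ∈ Submodule.span ℂ (Set.range (Binv hn)), ∃ q ∈ Submodule.span ℂ (Set.range (Bsgn hn)),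
      p + q = r := by
  rw [← Submodule.mem_sup]
  obtain ⟨H, rfl⟩ := hr
  change aeval _ H ∈ _
  induction H using MvPolynomial.induction_on' with
  | monomial u z =>
    rw [MvPolynomial.aeval_monomial, Finsupp.prod_fintype _ _ fun _ => pow_zero _,
      Fin.prod_univ_five, ← Algebra.smul_def]
    refine Submodule.smul_mem _ z ?_
    change genMonomial hn (u 0) (u 1) (u 2) (u 3) (u 4) ∈ _
    rcases Nat.mod_two_eq_zero_or_one (u 3 + u 4) with h | h
    · exact Submodule.mem_sup_left (genMonomial_mem_span_Binv hn h)
    · exact Submodule.mem_sup_right (genMonomial_mem_span_Bsgn hn h)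
  | add p q hp hq => rw [map_add]; exact add_mem hp hq

/-- The combination of `1, β₂, β₃, β₂², β₃²` with given coefficients. -/
abbrev coinvSum (r : Fin 5 → P n 3) : P n 3 :=
  r 0 + r 1 * β₂ hn + r 2 * β₃ hn + r 3 * β₂ hn ^ 2 + r 4 * β₃ hn ^ 2

/-- Rests on β₂β₃ = β₂² + β₃² - α₂, β₂³ = α₂β₂ - α₁γ₂ and 6β₂β₃² = 3α₁γ₂ - α₃ + 2α₂(β₂ + β₃). Five
generators suffice where the coinvariants of S₃ have dimension 6, because the top antisymmetric one
is α₁γ₂, already a scalar. -/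
theorem coinvSum_mul_β₂ {t : P n 3} (ht : 6 * t = 1) (r : Fin 5 → P n 3) :
    coinvSum hn r * β₂ hn = coinvSum hn
      ![-α₂ hn * r 2 - α₁ hn * γ₂ hn * r 3 + t * (3 * (α₁ hn * γ₂ hn) - α₃ hn) * r 4,
        r 0 + α₂ hn * r 3 + 2 * t * α₂ hn * r 4, 2 * t * α₂ hn * r 4, r 1 + r 2, r 2] := by
  simp only [coinvSum, Matrix.cons_val, α₂, α₃]
  linear_combination (-r 4 * β₂ hn * β₃ hn ^ 2) * ht + (r 3 - 3 * t * r 4) * α₁_mul_γ₂ hn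

theorem coinvSum_mul_β₃ {t : P n 3} (ht : 6 * t = 1) (r : Fin 5 → P n 3) :
    coinvSum hn r * β₃ hn = coinvSum hn
      ![-α₂ hn * r 1 - t * (3 * (α₁ hn * γ₂ hn) + α₃ hn) * r 3 + α₁ hn * γ₂ hn * r 4,
        2 * t * α₂ hn * r 3, r 0 + 2 * t * α₂ hn * r 3 + α₂ hn * r 4, r 1, r 1 + r 2] := by
  simp only [coinvSum, Matrix.cons_val, α₂, α₃]
  linear_combination (-r 3 * β₂ hn ^ 2 * β₃ hn) * ht + (3 * t * r 3 - r 4) * α₁_mul_γ₂ hn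

theorem exists_coinvSum_of_mem_genAlg {f : P n 3} (hf : f ∈ genAlg hn) :
    ∃ r : Fin 5 → P n 3, (∀ i, r i ∈ symAlg hn) ∧ f = coinvSum hn r := by
  have h₁ := α₁_mem_symAlg hn
  have h₂ := α₂_mem_symAlg hn
  have h₃ := α₃_mem_symAlg hn
  have h₄ := γ₁_mem_symAlg hn
  have h₅ := γ₂_mem_symAlg hn
  have mul_sym {g : P n 3} (hg : g ∈ symAlg hn) {r : Fin 5 → P n 3} (hr : ∀ i, r i ∈ symAlg hn) :
      ∃ r' : Fin 5 → P n 3, (∀ i, r' i ∈ symAlg hn) ∧ coinvSum hn r * g = coinvSum hn r' :=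
    ⟨fun i => r i * g, fun i => mul_mem (hr i) hg, by simp only [coinvSum]; ring⟩
  obtain ⟨t, ht, ht6⟩ : ∃ t ∈ symAlg hn, 6 * t = 1 := by
    refine ⟨C (1 / 6), (symAlg hn).algebraMap_mem (1 / 6), ?_⟩
    rw [← map_ofNat (C : ℂ →+* P n 3) 6, ← map_mul]
    norm_num
  have ofNat_mem (m : ℕ) [m.AtLeastTwo] : (ofNat(m) : P n 3) ∈ symAlg hn := ofNat_mem _ m
  obtain ⟨H, rfl⟩ := hf
  change ∃ r : Fin 5 → P n 3, (∀ i, r i ∈ symAlg hn) ∧ aeval (gens hn) H = coinvSum hn r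
  induction H using MvPolynomial.induction_on with
  | C z =>
    refine ⟨![C z, 0, 0, 0, 0], fun i => ?_, by simp [coinvSum]⟩
    fin_cases i
    · exact (symAlg hn).algebraMap_mem z
    all_goals exact zero_mem _
  | add p q hp hq =>
    obtain ⟨r, hr, hp⟩ := hp
    obtain ⟨r', hr', hq⟩ := hq
    refine ⟨r + r', fun i => add_mem (hr i) (hr' i), ?_⟩
    rw [map_add, hp, hq]
    simp only [coinvSum, Pi.add_apply]
    ring
  | mul_X p i hp =>
    obtain ⟨r, hr, hp⟩ := hp
    rw [map_mul, hp, MvPolynomial.aeval_X]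
    fin_cases i
    · exact mul_sym h₁ hr
    · refine ⟨_, fun i => ?_, coinvSum_mul_β₂ hn ht6 r⟩
      fin_cases i
      · exact add_mem (sub_mem (mul_mem (neg_mem h₂) (hr 2)) (mul_mem (mul_mem h₁ h₅) (hr 3)))
          (mul_mem (mul_mem ht (sub_mem (mul_mem (ofNat_mem 3) (mul_mem h₁ h₅)) h₃)) (hr 4))
      · exact add_mem (add_mem (hr 0) (mul_mem h₂ (hr 3)))
          (mul_mem (mul_mem (mul_mem (ofNat_mem 2) ht) h₂) (hr 4))
      · exact mul_mem (mul_mem (mul_mem (ofNat_mem 2) ht) h₂) (hr 4)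
      · exact add_mem (hr 1) (hr 2)
      · exact hr 2
    · refine ⟨_, fun i => ?_, coinvSum_mul_β₃ hn ht6 r⟩
      fin_cases i
      · exact add_mem (sub_mem (mul_mem (neg_mem h₂) (hr 1))
          (mul_mem (mul_mem ht (add_mem (mul_mem (ofNat_mem 3) (mul_mem h₁ h₅)) h₃)) (hr 3)))
          (mul_mem (mul_mem h₁ h₅) (hr 4))
      · exact mul_mem (mul_mem (mul_mem (ofNat_mem 2) ht) h₂) (hr 3)
      · exact add_mem (add_mem (hr 0) (mul_mem (mul_mem (mul_mem (ofNat_mem 2) ht) h₂) (hr 3)))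
          (mul_mem h₂ (hr 4))
      · exact hr 1
      · exact add_mem (hr 1) (hr 2)
    · exact mul_sym h₄ hr
    · exact mul_sym h₅ hr

theorem permAct_span_Binv {p : P n 3} (hp : p ∈ Submodule.span ℂ (Set.range (Binv hn))) :
    permAct s₂₃ p = p ∧ permAct s₁₂ p = p :=
  ⟨(span_Binv_le hn hp).1.2 _, (span_Binv_le hn hp).1.2 _⟩

theorem permAct_swap_of_mem_Qsgn {q : P n 3} (hq : q ∈ Qsgn n 3) :
    permAct s₂₃ q = -q ∧ permAct s₁₂ q = -q := by
  refine ⟨?_, ?_⟩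
  all_goals
    rw [hq.2, Equiv.Perm.sign_swap (by decide)]
    simp

theorem exists_coinvSum_span {f : P n 3} (hf : f ∈ genAlg hn) :
    ∃ p q : Fin 5 → P n 3, (∀ i, p i ∈ Submodule.span ℂ (Set.range (Binv hn))) ∧
      (∀ i, q i ∈ Submodule.span ℂ (Set.range (Bsgn hn))) ∧ f = coinvSum hn (p + q) := by
  obtain ⟨r, hr, rfl⟩ := exists_coinvSum_of_mem_genAlg hn hf
  choose p hp q hq h using fun i => exists_add_of_mem_symAlg hn (hr i)
  exact ⟨p, q, hp, hq, by rw [show p + q = r from funext h]⟩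

theorem six_mul_mem {W : Submodule ℂ (P n 3)} {f : P n 3} (h : 6 * f ∈ W) : f ∈ W := by
  have h' := W.smul_mem (1 / 6 : ℂ) h
  rw [← map_ofNat (C : ℂ →+* P n 3) 6, ← MvPolynomial.smul_eq_C_mul, smul_smul] at h'
  norm_num at h'
  exact h'

theorem mem_span_Binv {f : P n 3} (hf : f ∈ genAlg hn) (hs : permAct s₂₃ f = f)
    (hr : permAct s₁₂ f = f) : f ∈ Submodule.span ℂ (Set.range (Binv hn)) := by
  obtain ⟨p, q, hp, hq, hfpq⟩ := exists_coinvSum_span hn hf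
  have hps (i) := (permAct_span_Binv hn (hp i)).1
  have hpr (i) := (permAct_span_Binv hn (hp i)).2
  have hqs (i) := (permAct_swap_of_mem_Qsgn (span_Bsgn_le hn (hq i)).1).1
  have hqr (i) := (permAct_swap_of_mem_Qsgn (span_Bsgn_le hn (hq i)).1).2
  have h6 : 6 * f = f + permAct s₂₃ f + permAct s₁₂ f + permAct s₂₃ (permAct s₁₂ f) +
      permAct s₁₂ (permAct s₂₃ f) + permAct s₂₃ (permAct s₁₂ (permAct s₂₃ f)) := by
    simp only [hs, hr]
    ring
  -- The orbit sums of β₂, β₃ vanish and those of β₂², β₃² are 4α₂. The `q` terms cancel because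
  -- none of 1, β₂, β₃, β₂², β₃² has a sign component: β₂ and β₃ span the reflection representation,
  -- and each of 1, β₂², β₃² is fixed by a transposition.
  have key : 6 * f = (6 : ℂ) • p 0 + (4 : ℂ) • (α₂ hn * (p 3 + p 4)) := by
    rw [h6, hfpq]
    simp only [coinvSum, Pi.add_apply, map_add, map_mul, map_pow, map_neg, map_sub, hps, hpr, hqs,
      hqr, s₂₃_β₂, s₂₃_β₃, s₁₂_β₂, s₁₂_β₃, α₂, MvPolynomial.smul_eq_C_mul, map_ofNat]
    ring
  apply six_mul_mem
  rw [key]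
  exact add_mem (Submodule.smul_mem _ _ (hp 0))
    (Submodule.smul_mem _ _ (α₂_mul_mem_span_Binv hn (add_mem (hp 3) (hp 4))))

theorem mem_span_Bsgn {f : P n 3} (hf : f ∈ genAlg hn) (hs : permAct s₂₃ f = -f)
    (hr : permAct s₁₂ f = -f) : f ∈ Submodule.span ℂ (Set.range (Bsgn hn)) := by
  obtain ⟨p, q, hp, hq, hfpq⟩ := exists_coinvSum_span hn hf
  have hps (i) := (permAct_span_Binv hn (hp i)).1
  have hpr (i) := (permAct_span_Binv hn (hp i)).2
  have hqs (i) := (permAct_swap_of_mem_Qsgn (span_Bsgn_le hn (hq i)).1).1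
  have hqr (i) := (permAct_swap_of_mem_Qsgn (span_Bsgn_le hn (hq i)).1).2
  have h6 : 6 * f = f - permAct s₂₃ f - permAct s₁₂ f + permAct s₂₃ (permAct s₁₂ f) +
      permAct s₁₂ (permAct s₂₃ f) - permAct s₂₃ (permAct s₁₂ (permAct s₂₃ f)) := by
    simp only [hs, hr, map_neg]
    ring
  -- In the signed sum the roles swap: the signs of the `q i` cancel those of the sum, and the `p`
  -- terms drop out.
  have key : 6 * f = (6 : ℂ) • q 0 + (4 : ℂ) • (α₂ hn * (q 3 + q 4)) := by
    rw [h6, hfpq]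
    simp only [coinvSum, Pi.add_apply, map_add, map_mul, map_pow, map_neg, map_sub, hps, hpr, hqs,
      hqr, s₂₃_β₂, s₂₃_β₃, s₁₂_β₂, s₁₂_β₃, α₂, MvPolynomial.smul_eq_C_mul, map_ofNat]
    ring
  apply six_mul_mem
  rw [key]
  exact add_mem (Submodule.smul_mem _ _ (hq 0))
    (Submodule.smul_mem _ _ (α₂_mul_mem_span_Bsgn hn (add_mem (hq 3) (hq 4))))

end Spanning

end Plethysm

end

theorem mainTheorem1 {n : ℕ} (hn : 3 ≤ n) :
    Plethysm.IsBasisOf (Plethysm.Binv hn) (Plethysm.unipInv (Plethysm.Qinv n 3)) ∧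
      Plethysm.IsBasisOf (Plethysm.Bsgn hn) (Plethysm.unipInv (Plethysm.Qsgn n 3)) := by
  refine ⟨⟨Plethysm.linearIndependent_Binv hn, (Plethysm.span_Binv_le hn).antisymm ?_⟩,
    ⟨Plethysm.linearIndependent_Bsgn hn, (Plethysm.span_Bsgn_le hn).antisymm ?_⟩⟩
  · rintro f ⟨⟨hQ, hS⟩, hU⟩
    exact Plethysm.mem_span_Binv hn (Plethysm.mem_genAlg_of_mem_Q hn hQ hU) (hS _) (hS _)
  · rintro f ⟨hf, hU⟩
    obtain ⟨hs, hr⟩ := Plethysm.permAct_swap_of_mem_Qsgn hf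
    exact Plethysm.mem_span_Bsgn hn (Plethysm.mem_genAlg_of_mem_Q hn hf.1 hU) hs hr
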